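/- **Corollary (4-approximation for the median aggregate answer).** Consider the query "select groupname, count(*) from R group by groupname" over a probabilistic relation with $n$ independent tuples and $m$ groups, given by a matrix $P=[p_{i,j}]_{n\times m}$ of rational numbers $p_{i,j}\ge 0$ with $\sum_{j=1}^m p_{i,j}=1$ for every $i$, where $p_{i,j}$ is the probability that tuple $i$ takes group name $j$. A possible world is a map $w$ assigning a group to each tuple; it has probability $\prod_i p_{i,w(i)}$, and its answer is the vector $\mathbf r(w)\in\mathbb N^m$ whose $j$-th entry is the number of tuples $i$ with $w(i)=j$. Let $\mathbf r$ be the answer of the random world, let $d(x,y)=\sum_{j=1}^m (x_j-y_j)^2$, and let $\bar{\mathbf r}=\mathsf E[\mathbf r]$ be the mean answer. A possible answer is the answer of a world of non-zero probability, and a median answer $\mathbf r^m$ is a possible answer $a$ that minimizes $\mathsf E[d(a,\mathbf r)]$ among all possible answers. There is a deterministic algorithm that, for all $n$, $m$ and $P$, runs in time polynomial in the size of the input (that is, $n+m$ plus the total bit length of the numerators and denominators of the entries of $P$; time is the logarithmic cost on a random access machine) and returns a possible answer $\mathbf r^*$ that is closest to the mean answer, i.e. $d(\mathbf r^*,\bar{\mathbf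 r})\le d(a,\bar{\mathbf r})$ for every possible answer $a$, and that satisfies $$\mathsf E[d(\mathbf r^*,\mathbf r)]\;\le\;4\,\mathsf E[d(\mathbf r^m,\mathbf r)]$$ for every median answer $\mathbf r^m$. -/

import Mathlib

/-! ### Machine model

A random access machine with finitely many (program-addressed) integer registers and an
integer-indexed integer memory, in structured form, under the logarithmic cost criterion:
every operation is charged the bit lengths of its operands, addresses and results. -/

namespace RAM

/-- Charge for handling the integer `z`: its bit length (sign and delimiter included). -/
def len (z : ℤ) : ℕ := z.natAbs.size + 1

structure State where
  reg : ℕ → ℤ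
  mem : ℤ → ℤ

/-- Integer expressions; `mem e` reads the memory cell whose address is the value of `e`. -/
inductive Expr where
  | const (z : ℤ)
  | reg (k : ℕ)
  | mem (e : Expr)
  | add (a b : Expr)
  | sub (a b : Expr)
  | mul (a b : Expr)

namespace Expr

def eval (s : State) : Expr → ℤ
  | const z => z
  | reg k => s.reg k
  | mem e => s.mem (eval s e)
  | add a b => eval s a + eval s b
  | sub a b => eval s a - eval s b
  | mul a b => eval s a * eval s b

/-- Logarithmic cost of evaluating an expression. -/
def cost (s : State) : Expr → ℕ
  | const z => len z
  | reg k => len (s.reg k)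
  | mem e => cost s e + len (eval s e) + len (s.mem (eval s e))
  | add a b => cost s a + cost s b + len (eval s a) + len (eval s b)
  | sub a b => cost s a + cost s b + len (eval s a) + len (eval s b)
  | mul a b => cost s a + cost s b + len (eval s a) + len (eval s b)

end Expr

/-- Programs. `store a e` writes the value of `e` to the memory cell addressed by the value of
`a`; the tests of `ifPos` and `whilePos` ask whether the value of an expression is positive. -/
inductive Prog where
  | skip
  | set (k : ℕ) (e : Expr)
  | store (a e : Expr)
  | seq (c d : Prog)
  | ifPos (e : Expr) (c d : Prog)
  | whilePos (e : Expr) (c : Prog)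

/-- `Exec c s t s'`: program `c`, started in state `s`, halts in state `s'` after running time
(total logarithmic cost) `t`. -/
inductive Exec : Prog → State → ℕ → State → Prop where
  | skip (s : State) : Exec Prog.skip s 1 s
  | set (k : ℕ) (e : Expr) (s : State) :
      Exec (Prog.set k e) s (e.cost s + len (e.eval s))
        { s with reg := Function.update s.reg k (e.eval s) }
  | store (a e : Expr) (s : State) :
      Exec (Prog.store a e) s (a.cost s + e.cost s + len (a.eval s) + len (e.eval s))
        { s with mem := Function.update s.mem (a.eval s) (e.eval s) }
  | seq {c d : Prog} {s s₁ s₂ : State} {t₁ t₂ : ℕ} :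
      Exec c s t₁ s₁ → Exec d s₁ t₂ s₂ → Exec (Prog.seq c d) s (t₁ + t₂) s₂
  | ifTrue {e : Expr} {c d : Prog} {s s₁ : State} {t : ℕ} :
      0 < e.eval s → Exec c s t s₁ →
      Exec (Prog.ifPos e c d) s (e.cost s + len (e.eval s) + t) s₁
  | ifFalse {e : Expr} {c d : Prog} {s s₁ : State} {t : ℕ} :
      ¬ 0 < e.eval s → Exec d s t s₁ →
      Exec (Prog.ifPos e c d) s (e.cost s + len (e.eval s) + t) s₁
  | whileTrue {e : Expr} {c : Prog} {s s₁ s₂ : State} {t₁ t₂ : ℕ} :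
      0 < e.eval s → Exec c s t₁ s₁ → Exec (Prog.whilePos e c) s₁ t₂ s₂ →
      Exec (Prog.whilePos e c) s (e.cost s + len (e.eval s) + t₁ + t₂) s₂
  | whileFalse {e : Expr} {c : Prog} {s : State} :
      ¬ 0 < e.eval s → Exec (Prog.whilePos e c) s (e.cost s + len (e.eval s)) s

/-- The machine is deterministic: final state and running time are determined by the input. -/
theorem Exec.deterministic {c : Prog} {s s₁ s₂ : State} {t₁ t₂ : ℕ}
    (h₁ : Exec c s t₁ s₁) (h₂ : Exec c s t₂ s₂) : t₁ = t₂ ∧ s₁ = s₂ := by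
  induction h₁ generalizing t₂ s₂ with
  | skip s => cases h₂; exact ⟨rfl, rfl⟩
  | set k e s => cases h₂; exact ⟨rfl, rfl⟩
  | store a e s => cases h₂; exact ⟨rfl, rfl⟩
  | seq _ _ ih₁ ih₂ =>
    cases h₂ with
    | seq g₁ g₂ =>
      obtain ⟨rfl, rfl⟩ := ih₁ g₁
      obtain ⟨rfl, rfl⟩ := ih₂ g₂
      exact ⟨rfl, rfl⟩
  | ifTrue hp _ ih =>
    cases h₂ with
    | ifTrue _ g => obtain ⟨rfl, rfl⟩ := ih g; exact ⟨rfl, rfl⟩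
    | ifFalse hn _ => exact absurd hp hn
  | ifFalse hn _ ih =>
    cases h₂ with
    | ifTrue hp _ => exact absurd hp hn
    | ifFalse _ g => obtain ⟨rfl, rfl⟩ := ih g; exact ⟨rfl, rfl⟩
  | whileTrue hp _ _ ih₁ ih₂ =>
    cases h₂ with
    | whileTrue _ g₁ g₂ =>
      obtain ⟨rfl, rfl⟩ := ih₁ g₁
      obtain ⟨rfl, rfl⟩ := ih₂ g₂
      exact ⟨rfl, rfl⟩
    | whileFalse hn => exact absurd hp hn
  | whileFalse hn =>
    cases h₂ with
    | whileTrue hp _ _ => exact absurd hp hn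
    | whileFalse _ => exact ⟨rfl, rfl⟩

end RAM

/-! ### Group-by count queries with attribute-level uncertainty -/

/-- `n` independent tuples with uncertain group name among `m` groups; `prob i j` is the
probability that tuple `i` takes group name `j`. -/
structure ProbRel (n m : ℕ) where
  prob : Fin n → Fin m → ℚ
  nonneg : ∀ i j, 0 ≤ prob i j
  sum_eq_one : ∀ i, ∑ j, prob i j = 1

/-- Squared Euclidean distance. -/
def sqDist {m : ℕ} (x y : Fin m → ℝ) : ℝ := ∑ j, (x j - y j) ^ 2

/-- The answer of `select groupname, count(*) from R group by groupname` in the world in which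
tuple `i` takes the group name `w i`. -/
def groupCount {n m : ℕ} (w : Fin n → Fin m) (j : Fin m) : ℕ :=
  (Finset.univ.filter fun i => w i = j).card

/-- A vector of counts as a real vector. -/
def toRealVec {m : ℕ} (a : Fin m → ℕ) (j : Fin m) : ℝ := a j

namespace ProbRel

variable {n m : ℕ} (P : ProbRel n m)

/-- Probability of a possible world; the tuples are independent. -/
def worldProb (w : Fin n → Fin m) : ℝ := ∏ i, (P.prob i (w i) : ℝ)

/-- Expectation of a function of the random world. -/
def expect (f : (Fin n → Fin m) → ℝ) : ℝ := ∑ w, P.worldProb w * f w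

/-- Expected squared distance of the vector `x` to the random answer. -/
def expDist (x : Fin m → ℝ) : ℝ := P.expect fun w => sqDist x (toRealVec (groupCount w))

/-- The mean answer: the mean of each count. -/
def meanAnswer (j : Fin m) : ℝ := P.expect fun w => (groupCount w j : ℝ)

/-- Answers of worlds of non-zero probability. -/
def IsPossibleAnswer (a : Fin m → ℕ) : Prop :=
  ∃ w : Fin n → Fin m, 0 < P.worldProb w ∧ groupCount w = a

/-- Median answers: the possible answers of least expected distance to the random answer. -/
def IsMedianAnswer (a : Fin m → ℕ) : Prop :=
  P.IsPossibleAnswer a ∧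
    ∀ b, P.IsPossibleAnswer b → P.expDist (toRealVec a) ≤ P.expDist (toRealVec b)

/-- `a` is a possible answer closest to the mean answer. -/
def IsClosestToMean (a : Fin m → ℕ) : Prop :=
  P.IsPossibleAnswer a ∧ ∀ b, P.IsPossibleAnswer b →
    sqDist (toRealVec a) P.meanAnswer ≤ sqDist (toRealVec b) P.meanAnswer

/-- `a` is an approximate median answer, within a factor `c` of the optimum. -/
def IsApproxMedianAnswer (c : ℝ) (a : Fin m → ℕ) : Prop :=
  P.IsPossibleAnswer a ∧
    ∀ b, P.IsMedianAnswer b → P.expDist (toRealVec a) ≤ c * P.expDist (toRealVec b)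

/-- Bit size of the input: the `n` tuples and `m` groups are listed, and the numerator and
denominator of every probability are written in binary. -/
def inputSize : ℕ :=
  n + m + ∑ i, ∑ j, (RAM.len (P.prob i j).num + RAM.len ((P.prob i j).den : ℤ))

/-- Initial machine state: `n` and `m` are in registers `0` and `1`; numerator and denominator
of `prob i j` are in the memory cells `2 * (i * m + j)` and `2 * (i * m + j) + 1`; all other
registers and cells are `0`. -/
def initState : RAM.State where
  reg := fun k => if k = 0 then (n : ℤ) else if k = 1 then (m : ℤ) else 0
  mem := fun z => ∑ i : Fin n, ∑ j : Fin m,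
    ((if z = 2 * ((i : ℤ) * m + j) then (P.prob i j).num else 0) +
      (if z = 2 * ((i : ℤ) * m + j) + 1 then ((P.prob i j).den : ℤ) else 0))

theorem worldProb_nonneg (w : Fin n → Fin m) : 0 ≤ P.worldProb w :=
  Finset.prod_nonneg fun i _ => by exact_mod_cast P.nonneg i (w i)

theorem sum_worldProb : ∑ w, P.worldProb w = 1 := by
  have h : ∏ i, ∑ j, (P.prob i j : ℝ) = 1 :=
    Finset.prod_eq_one fun i _ => by exact_mod_cast P.sum_eq_one i
  rw [← h, Finset.prod_univ_sum, Fintype.piFinset_univ]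
  rfl

/-- The mean answer minimizes the expected squared distance over all real vectors. -/
theorem expDist_meanAnswer_le (x : Fin m → ℝ) : P.expDist P.meanAnswer ≤ P.expDist x := by
  have key : ∀ y : Fin m → ℝ, P.expDist y =
      ∑ j, (y j ^ 2 - 2 * y j * P.meanAnswer j
        + P.expect fun w => (groupCount w j : ℝ) ^ 2) := by
    intro y
    unfold expDist expect sqDist meanAnswer expect toRealVec
    simp_rw [Finset.mul_sum]
    rw [Finset.sum_comm]
    refine Finset.sum_congr rfl fun j _ => ?_
    have h1 : y j ^ 2 = ∑ w, P.worldProb w * y j ^ 2 := by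
      rw [← Finset.sum_mul, P.sum_worldProb, one_mul]
    rw [h1, ← Finset.sum_sub_distrib, ← Finset.sum_add_distrib]
    exact Finset.sum_congr rfl fun w _ => by ring
  rw [key, key]
  refine Finset.sum_le_sum fun j _ => ?_
  nlinarith [sq_nonneg (x j - P.meanAnswer j)]

/-- A median answer exists. -/
theorem exists_isMedianAnswer : ∃ a, P.IsMedianAnswer a := by
  classical
  have hne : (Finset.univ.filter fun w => 0 < P.worldProb w).Nonempty := by
    by_contra h
    rw [Finset.not_nonempty_iff_eq_empty, Finset.filter_eq_empty_iff] at h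
    have h0 : ∑ w, P.worldProb w = 0 := Finset.sum_eq_zero fun w hw =>
      le_antisymm (not_lt.mp (h hw)) (P.worldProb_nonneg w)
    rw [P.sum_worldProb] at h0
    exact one_ne_zero h0
  obtain ⟨w, hw, hmin⟩ := Finset.exists_min_image _
    (fun w => P.expDist (toRealVec (groupCount w))) hne
  refine ⟨groupCount w, ⟨w, (Finset.mem_filter.mp hw).2, rfl⟩, ?_⟩
  rintro b ⟨v, hv, rfl⟩
  exact hmin v (Finset.mem_filter.mpr ⟨Finset.mem_univ _, hv⟩)

end ProbRel

/-! ### Bit lengths and cost of expressions. -/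

namespace RAM

/-! The expected squared distance splits as `E d(x, r) = d(x, r̄) + E d(r̄, r)`
(`ProbRel.expDist_eq`). The second term does not depend on `x`, so a possible answer closest to the
mean is itself a median answer, and the factor 4 is slack. What remains is to find a closest
possible answer in polynomial time.

A world of non-zero probability puts every tuple into an admissible group, one of positive
probability, and the mean count of group `k` is `μ k = ∑ i, p i k`. Minimizing `∑ k, (c k - μ k) ^
2` over the counts `c` of such assignments is a separable convex problem, solved by successive
augmentation. Unassigned tuples sit in a fictitious group `m`. Each of `n` augmentations explores
from `m` the exchange graph, where a tuple leads from its group to each group admissible for it,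
picks a reached real group `b` of least excess `c b - μ b`, and shifts tuples along a path from `m`
to `b`, so that among the real groups only `b` grows.

Optimality is certified by a potential `y` with `c k - μ k - 1 ≤ y k ≤ c k - μ k` that does not
decrease when an assigned tuple moves. By convexity, passing to counts `c'` costs at least `∑ k, (2
* y k + 1) * (c' k - c k)`, which is nonnegative when both assignments place all tuples
(`sqDist_le_of_potential`). An augmentation keeps a potential in existence: raise `y` on the reached
groups to at least the old excess of `b` (`Assign.Search.exists_isPotential`). The machine never
computes `y`.

For the running time, all loops are counted loops of at most `U` iterations and all stored numbers
have at most `U` bits, with `U` linear in the input size; the time is then at most a polynomial in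
`U` read off the program (`Prog.timeBound`, `WP`). The means are kept exactly, as fractions over
products of denominators, whose bit lengths only add up. -/

theorem len_le_of_natAbs_lt {z : ℤ} {b : ℕ} (h : z.natAbs < 2 ^ b) : len z ≤ b + 1 :=
  Nat.succ_le_succ (Nat.size_le.mpr h)

theorem natAbs_lt_two_pow_len (z : ℤ) : z.natAbs < 2 ^ len z :=
  Nat.size_le.mp (Nat.le_succ _)

/-- All registers and memory cells hold integers of at most `U` bits. -/
def Bounded (U : ℕ) (s : State) : Prop :=
  (∀ k, (s.reg k).natAbs < 2 ^ U) ∧ ∀ z, (s.mem z).natAbs < 2 ^ U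

namespace Expr

/-- The value of `e` has at most `e.width * (U + 1)` bits in a state bounded by `U`. -/
def width : Expr → ℕ
  | const z => len z
  | reg _ => 1
  | mem _ => 1
  | add a b => width a + width b
  | sub a b => width a + width b
  | mul a b => width a + width b

/-- The cost of `e` is at most `e.weight * (U + 1)` in a state bounded by `U`. -/
def weight : Expr → ℕ
  | const z => len z
  | reg _ => 1
  | mem e => weight e + (width e + 1) + 1
  | add a b => weight a + weight b + (width a + 1) + (width b + 1)
  | sub a b => weight a + weight b + (width a + 1) + (width b + 1)
  | mul a b => weight a + weight b + (width a + 1) + (width b + 1)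

theorem one_le_width (e : Expr) : 1 ≤ e.width := by
  induction e <;> simp only [width, len] <;> omega

theorem two_pow_add_two_pow_le {a b : ℕ} (ha : 1 ≤ a) (hb : 1 ≤ b) :
    2 ^ a + 2 ^ b ≤ 2 ^ (a + b) := by
  have h1 : 2 ≤ 2 ^ a := by simpa using Nat.pow_le_pow_right (n := 2) (by norm_num) ha
  have h2 : 2 ≤ 2 ^ b := by simpa using Nat.pow_le_pow_right (n := 2) (by norm_num) hb
  rw [pow_add]
  nlinarith

/-- Sums, differences and products of numbers of `a` and `b` bits have at most `a + b` bits once `a`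
and `b` are positive, so the width is additive in all three cases. -/
theorem natAbs_eval_lt {U : ℕ} {s : State} (hs : Bounded U s) (e : Expr) :
    (e.eval s).natAbs < 2 ^ (e.width * (U + 1)) := by
  have hw : ∀ e : Expr, 1 ≤ e.width * (U + 1) := fun e =>
    Nat.mul_pos e.one_le_width U.succ_pos
  induction e with
  | const z =>
    exact (natAbs_lt_two_pow_len z).trans_le
      (Nat.pow_le_pow_right (by norm_num) (Nat.le_mul_of_pos_right _ U.succ_pos))
  | reg k =>
    exact (hs.1 k).trans_le (Nat.pow_le_pow_right (by norm_num) (by simp [width]))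
  | mem e =>
    exact (hs.2 _).trans_le (Nat.pow_le_pow_right (by norm_num) (by simp [width]))
  | add a b iha ihb =>
    have := two_pow_add_two_pow_le (hw a) (hw b)
    simp only [eval, width, add_mul]
    have := Int.natAbs_add_le (a.eval s) (b.eval s)
    omega
  | sub a b iha ihb =>
    have := two_pow_add_two_pow_le (hw a) (hw b)
    simp only [eval, width, add_mul]
    have := Int.natAbs_sub_le (a.eval s) (b.eval s)
    omega
  | mul a b iha ihb =>
    simp only [eval, width, add_mul, Int.natAbs_mul, pow_add]
    exact Nat.mul_lt_mul'' iha ihb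

theorem len_eval_le {U : ℕ} {s : State} (hs : Bounded U s) (e : Expr) :
    len (e.eval s) ≤ (e.width + 1) * (U + 1) := by
  have := len_le_of_natAbs_lt (natAbs_eval_lt hs e)
  rw [add_mul]
  omega

theorem cost_le {U : ℕ} {s : State} (hs : Bounded U s) (e : Expr) :
    e.cost s ≤ e.weight * (U + 1) := by
  induction e with
  | const z => exact Nat.le_mul_of_pos_right _ U.succ_pos
  | reg k => simpa [weight, cost] using len_le_of_natAbs_lt (hs.1 k)
  | mem e ih =>
    have h1 := len_eval_le hs e
    have h2 := len_le_of_natAbs_lt (hs.2 (e.eval s))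
    simp only [cost, weight, add_mul] at *
    omega
  | add a b iha ihb | sub a b iha ihb | mul a b iha ihb =>
    have h1 := len_eval_le hs a
    have h2 := len_eval_le hs b
    simp only [cost, weight, add_mul] at *
    omega

/-- Weight of evaluating `e` and handling its value. -/
def load (e : Expr) : ℕ := e.weight + (e.width + 1)

theorem cost_add_len_le {U : ℕ} {s : State} (hs : Bounded U s) (e : Expr) :
    e.cost s + len (e.eval s) ≤ e.load * (U + 1) := by
  rw [load, add_mul]
  exact add_le_add (cost_le hs e) (len_eval_le hs e)

end Expr

/-- Running time in states bounded by `U` when no loop is iterated more than `U` times. -/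
noncomputable def Prog.timeBound : Prog → Polynomial ℕ
  | skip => 1
  | set _ e => Polynomial.C e.load * (Polynomial.X + 1)
  | store a e => Polynomial.C (a.load + e.load) * (Polynomial.X + 1)
  | seq c d => timeBound c + timeBound d
  | ifPos e c d => Polynomial.C e.load * (Polynomial.X + 1) + timeBound c + timeBound d
  | whilePos e c =>
    Polynomial.X * (Polynomial.C e.load * (Polynomial.X + 1) + timeBound c)
      + Polynomial.C e.load * (Polynomial.X + 1)

/-- Weakest precondition, including the time bound `Prog.timeBound` and boundedness by `U`. -/
def WP (U : ℕ) (c : Prog) (Q : State → Prop) (s : State) : Prop :=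
  Bounded U s → ∃ t s', Exec c s t s' ∧ t ≤ c.timeBound.eval U ∧ Bounded U s' ∧ Q s'

namespace State

def setReg (s : State) (k : ℕ) (v : ℤ) : State := { s with reg := Function.update s.reg k v }

def setMem (s : State) (z : ℤ) (v : ℤ) : State := { s with mem := Function.update s.mem z v }

@[simp] theorem setReg_mem (s : State) (k : ℕ) (v z : ℤ) : (s.setReg k v).mem z = s.mem z := rfl

@[simp] theorem setMem_reg (s : State) (z v : ℤ) (k : ℕ) : (s.setMem z v).reg k = s.reg k := rfl

@[simp] theorem setReg_reg_self (s : State) (k : ℕ) (v : ℤ) : (s.setReg k v).reg k = v := by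
  simp [setReg]

theorem setReg_reg (s : State) (k l : ℕ) (v : ℤ) :
    (s.setReg k v).reg l = if l = k then v else s.reg l := by
  simp [setReg, Function.update_apply]

@[simp] theorem setReg_reg_of_ne (s : State) {k l : ℕ} (v : ℤ) (h : l ≠ k) :
    (s.setReg k v).reg l = s.reg l := by
  simp [setReg, h]

theorem setMem_mem (s : State) (z z' v : ℤ) :
    (s.setMem z v).mem z' = if z' = z then v else s.mem z' := by
  simp [setMem, Function.update_apply]

end State

theorem Bounded.setReg {U : ℕ} {s : State} (hs : Bounded U s) {k : ℕ} {v : ℤ}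
    (hv : v.natAbs < 2 ^ U) : Bounded U (s.setReg k v) := by
  refine ⟨fun l => ?_, hs.2⟩
  rw [State.setReg_reg]
  split_ifs
  exacts [hv, hs.1 l]

theorem Bounded.setMem {U : ℕ} {s : State} (hs : Bounded U s) {z v : ℤ}
    (hv : v.natAbs < 2 ^ U) : Bounded U (s.setMem z v) := by
  refine ⟨hs.1, fun l => ?_⟩
  rw [State.setMem_mem]
  split_ifs
  exacts [hv, hs.2 l]

/-! ### Program logic with time and size bounds. -/

namespace WP

variable {U : ℕ} {s : State} {Q R : State → Prop}

theorem mono {c : Prog} (h : WP U c R s) (hQ : ∀ s', R s' → Q s') : WP U c Q s := fun hs =>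
  let ⟨t, s', h1, h2, h3, h4⟩ := h hs
  ⟨t, s', h1, h2, h3, hQ s' h4⟩

/-- Needed where a value is copied from memory: its size is known only because it already occurs in
the current state. -/
theorem of_bounded {c : Prog} (h : Bounded U s → WP U c Q s) : WP U c Q s := fun hs => h hs hs

theorem skip (h : Q s) : WP U Prog.skip Q s := fun hs =>
  ⟨1, s, Exec.skip s, by simp [Prog.timeBound], hs, h⟩

theorem set {k : ℕ} {e : Expr} (hv : (e.eval s).natAbs < 2 ^ U)
    (h : Q (s.setReg k (e.eval s))) : WP U (Prog.set k e) Q s := fun hs =>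
  ⟨_, _, Exec.set k e s, by simpa [Prog.timeBound] using Expr.cost_add_len_le hs e,
    hs.setReg hv, h⟩

theorem store {a e : Expr} (hv : (e.eval s).natAbs < 2 ^ U)
    (h : Q (s.setMem (a.eval s) (e.eval s))) : WP U (Prog.store a e) Q s := fun hs =>
  ⟨_, _, Exec.store a e s, by
    have h1 := Expr.cost_add_len_le hs e
    have h2 := Expr.cost_add_len_le hs a
    simp only [Prog.timeBound, Polynomial.eval_mul, Polynomial.eval_C, Polynomial.eval_add,
      Polynomial.eval_X, Polynomial.eval_one, add_mul] at *
    omega, hs.setMem hv, h⟩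

theorem seq {c d : Prog} (h : WP U c (WP U d Q) s) : WP U (Prog.seq c d) Q s := fun hs =>
  let ⟨t, s', h1, h2, h3, h4⟩ := h hs
  let ⟨t', s'', g1, g2, g3, g4⟩ := h4 h3
  ⟨t + t', s'', Exec.seq h1 g1, by simpa [Prog.timeBound] using add_le_add h2 g2, g3, g4⟩

theorem ifPos {e : Expr} {c d : Prog} (hc : 0 < e.eval s → WP U c Q s)
    (hd : ¬ 0 < e.eval s → WP U d Q s) : WP U (Prog.ifPos e c d) Q s := fun hs => by
  have he := Expr.cost_add_len_le hs e
  by_cases h : 0 < e.eval s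
  · obtain ⟨t, s', h1, h2, h3, h4⟩ := hc h hs
    refine ⟨_, s', Exec.ifTrue h h1, ?_, h3, h4⟩
    simp only [Prog.timeBound, Polynomial.eval_mul, Polynomial.eval_C, Polynomial.eval_add,
      Polynomial.eval_X, Polynomial.eval_one]
    omega
  · obtain ⟨t, s', h1, h2, h3, h4⟩ := hd h hs
    refine ⟨_, s', Exec.ifFalse h h1, ?_, h3, h4⟩
    simp only [Prog.timeBound, Polynomial.eval_mul, Polynomial.eval_C, Polynomial.eval_add,
      Polynomial.eval_X, Polynomial.eval_one]
    omega

end WP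

/-- `for reg k = 0, …, reg b - 1 do c`. -/
def Prog.forTo (k b : ℕ) (c : Prog) : Prog :=
  seq (set k (.const 0)) (whilePos (.sub (.reg b) (.reg k))
    (seq c (set k (.add (.reg k) (.const 1)))))

/-- The only loop rule. The counter stays below `N ≤ U`, which bounds both its bit length and the
number of iterations charged by `Prog.timeBound`. -/
theorem WP.forTo {U : ℕ} {s : State} {Q : State → Prop} {k b : ℕ} {c : Prog}
    (I : ℕ → State → Prop) {N : ℕ} (hkb : b ≠ k) (hN : s.reg b = N) (hNU : N ≤ U)
    (h0 : I 0 (s.setReg k 0))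
    (hstep : ∀ j < N, ∀ s', I j s' → s'.reg k = j → s'.reg b = N →
      WP U c (fun s'' => s''.reg k = j ∧ s''.reg b = N ∧
        I (j + 1) (s''.setReg k ((j + 1 : ℕ) : ℤ))) s')
    (hQ : ∀ s', I N s' → s'.reg k = N → s'.reg b = N → Q s') :
    WP U (Prog.forTo k b c) Q s := by
  refine WP.seq (WP.set (by simp [Expr.eval]) ?_)
  set e : Expr := .sub (.reg b) (.reg k) with he
  set d : Prog := .seq c (.set k (.add (.reg k) (.const 1))) with hd
  have hbody : ∀ j < N, ∀ s', I j s' → s'.reg k = j → s'.reg b = N →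
      WP U d (fun s'' => I (j + 1) s'' ∧ s''.reg k = (j + 1 : ℕ) ∧ s''.reg b = N) s' := by
    intro j hj s' h1 h2 h3
    refine WP.seq ((hstep j hj s' h1 h2 h3).mono fun s'' ⟨g1, g2, g3⟩ => WP.set ?_ ?_)
    · have : (j + 1 : ℕ) < 2 ^ U := lt_of_le_of_lt (by omega) (Nat.lt_two_pow_self)
      simp only [Expr.eval, g1]
      omega
    · simp only [Expr.eval, g1]
      push_cast at g3 ⊢
      exact ⟨g3, by simp, by simpa [hkb] using g2⟩
  -- Induction on the number `r` of remaining iterations; the last summand pays for the final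
  -- failing test.
  have key : ∀ r j, j + r = N → ∀ s', I j s' → s'.reg k = j → s'.reg b = N → Bounded U s' →
      ∃ t s'', Exec (.whilePos e d) s' t s'' ∧
        t ≤ r * (e.load * (U + 1) + d.timeBound.eval U) + e.load * (U + 1) ∧
        Bounded U s'' ∧ Q s'' := by
    intro r
    induction r with
    | zero =>
      intro j hj s' h1 h2 h3 hs
      obtain rfl : j = N := by omega
      refine ⟨_, s', Exec.whileFalse ?_, ?_, hs, hQ s' h1 h2 h3⟩
      · simp [he, Expr.eval, h2, h3]
      · simpa using Expr.cost_add_len_le hs e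
    | succ r ih =>
      intro j hj s' h1 h2 h3 hs
      obtain ⟨t, s1, g1, g2, g3, g4, g5, g6⟩ := hbody j (by omega) s' h1 h2 h3 hs
      obtain ⟨t', s2, f1, f2, f3, f4⟩ := ih (j + 1) (by omega) s1 g4 g5 g6 g3
      refine ⟨_, s2, Exec.whileTrue ?_ g1 f1, ?_, f3, f4⟩
      · simp only [he, Expr.eval, h2, h3]
        omega
      · have := Expr.cost_add_len_le hs e
        rw [add_mul r 1, one_mul]
        omega
  intro hs
  obtain ⟨t, s', h1, h2, h3, h4⟩ := key N 0 (by omega) _ h0 (by simp)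
    (by simpa [hkb] using hN) hs
  refine ⟨t, s', h1, h2.trans ?_, h3, h4⟩
  simp only [Prog.timeBound, Polynomial.eval_mul, Polynomial.eval_C, Polynomial.eval_add,
    Polynomial.eval_X, Polynomial.eval_one]
  gcongr

/-! ### Arrays at negative addresses -/

/-- Address of entry `(k, i)` of the array number `r`. -/
def cell (r : ℕ) (k i : ℤ) : ℤ :=
  -1 - ((r + ((k + i) * (k + i) + i)) * (r + ((k + i) * (k + i) + i)) + ((k + i) * (k + i) + i))

/-- Since `b ≤ a + b`, the value lies between `(a + b) ^ 2` and `(a + b + 1) ^ 2`, so it determines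
`a + b`. Nesting this pairing twice makes `cell` injective. -/
theorem eq_of_sq_add_eq {a b c d : ℕ}
    (h : (a + b) * (a + b) + b = (c + d) * (c + d) + d) : a = c ∧ b = d := by
  have h1 : a + b = c + d := by
    rcases lt_trichotomy (a + b) (c + d) with h1 | h1 | h1
    · nlinarith
    · exact h1
    · nlinarith
  rw [h1] at h
  omega

@[simp] theorem cell_eq_cell {r r' k k' i i' : ℕ} :
    cell r (k : ℤ) (i : ℤ) = cell r' (k' : ℤ) (i' : ℤ) ↔ r = r' ∧ k = k' ∧ i = i' := by
  refine ⟨fun h => ?_, by rintro ⟨rfl, rfl, rfl⟩; rfl⟩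
  simp only [cell, sub_right_inj] at h
  obtain ⟨h1, h2⟩ := eq_of_sq_add_eq (by exact_mod_cast h)
  exact ⟨h1, eq_of_sq_add_eq h2⟩

theorem cell_neg (r k i : ℕ) : cell r (k : ℤ) (i : ℤ) < 0 := by
  unfold cell
  have : (0 : ℤ) ≤ (r + ((k + i) * (k + i) + i)) * (r + ((k + i) * (k + i) + i))
    + ((k + i) * (k + i) + i) := by positivity
  omega

def Expr.cell (r : ℕ) (k i : Expr) : Expr :=
  .sub (.const (-1)) (.add (.mul (.add (.const r) (.add (.mul (.add k i) (.add k i)) i))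
    (.add (.const r) (.add (.mul (.add k i) (.add k i)) i))) (.add (.mul (.add k i) (.add k i)) i))

@[simp] theorem Expr.eval_cell (s : State) (r : ℕ) (k i : Expr) :
    (Expr.cell r k i).eval s = RAM.cell r (k.eval s) (i.eval s) := rfl

def State.get (s : State) (r k i : ℕ) : ℤ := s.mem (cell r k i)

def State.put (s : State) (r k i : ℕ) (v : ℤ) : State := s.setMem (cell r k i) v

@[simp] theorem State.put_reg (s : State) (r k i l : ℕ) (v : ℤ) :
    (s.put r k i v).reg l = s.reg l := rfl

@[simp] theorem State.setReg_get (s : State) (r k i l : ℕ) (v : ℤ) :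
    (s.setReg l v).get r k i = s.get r k i := rfl

theorem State.put_get (s : State) (r k i r' k' i' : ℕ) (v : ℤ) :
    (s.put r k i v).get r' k' i' = if r' = r ∧ k' = k ∧ i' = i then v else s.get r' k' i' := by
  simp [State.put, State.get, State.setMem_mem]

theorem State.put_mem (s : State) (r k i : ℕ) (v : ℤ) {z : ℤ} (hz : 0 ≤ z) :
    (s.put r k i v).mem z = s.mem z := by
  have := cell_neg r k i
  rw [State.put, State.setMem_mem, if_neg (by omega)]

theorem State.setMem_get (s : State) (r k i : ℕ) (v : ℤ) {z : ℤ} (hz : 0 ≤ z) :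
    (s.setMem z v).get r k i = s.get r k i := by
  have := cell_neg r k i
  rw [State.get, State.setMem_mem, if_neg (by omega), State.get]

def Expr.get (r : ℕ) (k i : Expr) : Expr := .mem (.cell r k i)

theorem Expr.eval_get {s : State} {r k i : ℕ} {ek ei : Expr} (hk : ek.eval s = k)
    (hi : ei.eval s = i) : (Expr.get r ek ei).eval s = s.get r k i := by
  simp [Expr.get, Expr.eval, State.get, hk, hi]

def Prog.put (r : ℕ) (k i e : Expr) : Prog := .store (.cell r k i) e

theorem WP.put {U : ℕ} {s : State} {Q : State → Prop} {r k i : ℕ} {ek ei e : Expr} {v : ℤ}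
    (hk : ek.eval s = k) (hi : ei.eval s = i) (hv : e.eval s = v) (hb : v.natAbs < 2 ^ U)
    (h : Q (s.put r k i v)) : WP U (Prog.put r ek ei e) Q s := by
  refine WP.store (by rwa [hv]) ?_
  rwa [Expr.eval_cell, hk, hi, hv]

theorem Bounded.get {U : ℕ} {s : State} (hs : Bounded U s) (r k i : ℕ) :
    (s.get r k i).natAbs < 2 ^ U := hs.2 _

/-- The registers below `d` and the nonnegative memory cells agree. -/
def Frame (d : ℕ) (s s' : State) : Prop :=
  (∀ l < d, s'.reg l = s.reg l) ∧ ∀ z, 0 ≤ z → s'.mem z = s.mem z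

namespace Frame

variable {d d' : ℕ} {s s' s'' : State}

theorem refl (d : ℕ) (s : State) : Frame d s s := ⟨fun _ _ => rfl, fun _ _ => rfl⟩

theorem trans (h : Frame d s s') (h' : Frame d s' s'') : Frame d s s'' :=
  ⟨fun l hl => (h'.1 l hl).trans (h.1 l hl), fun z hz => (h'.2 z hz).trans (h.2 z hz)⟩

theorem anti (h : Frame d s s') (hd : d' ≤ d) : Frame d' s s' :=
  ⟨fun l hl => h.1 l (hl.trans_le hd), h.2⟩

theorem setReg (h : Frame d s s') {k : ℕ} (hk : d ≤ k) (v : ℤ) : Frame d s (s'.setReg k v) :=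
  ⟨fun l hl => by rw [State.setReg_reg_of_ne _ _ (by omega), h.1 l hl], h.2⟩

theorem put (h : Frame d s s') (r k i : ℕ) (v : ℤ) : Frame d s (s'.put r k i v) :=
  ⟨h.1, fun z hz => by rw [State.put_mem _ _ _ _ _ hz, h.2 z hz]⟩

end Frame

end RAM

/-! ### Optimal assignments -/

namespace Assign

/-- Number of tuples below `n` assigned to group `k`. -/
def cnt (n : ℕ) (w : ℕ → ℕ) (k : ℕ) : ℕ := ∑ i ∈ Finset.range n, if w i = k then 1 else 0

theorem cnt_le (n : ℕ) (w : ℕ → ℕ) (k : ℕ) : cnt n w k ≤ n := by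
  calc cnt n w k ≤ ∑ _i ∈ Finset.range n, 1 :=
        Finset.sum_le_sum fun i _ => by split_ifs <;> simp
    _ = n := by simp

theorem cnt_congr {n : ℕ} {w w' : ℕ → ℕ} (h : ∀ i < n, w i = w' i) (k : ℕ) :
    cnt n w k = cnt n w' k :=
  Finset.sum_congr rfl fun i hi => by rw [h i (Finset.mem_range.mp hi)]

/-- The additive form avoids truncated subtraction and includes the case `k = w i`. -/
theorem cnt_update {n : ℕ} (w : ℕ → ℕ) {i : ℕ} (hi : i < n) (k j : ℕ) :
    cnt n (Function.update w i k) j + (if j = w i then 1 else 0)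
      = cnt n w j + (if j = k then 1 else 0) := by
  have hm : i ∈ Finset.range n := Finset.mem_range.mpr hi
  unfold cnt
  rw [← Finset.add_sum_erase _ _ hm, ← Finset.add_sum_erase _ _ hm]
  have : ∑ x ∈ (Finset.range n).erase i, (if Function.update w i k x = j then 1 else 0)
      = ∑ x ∈ (Finset.range n).erase i, (if w x = j then 1 else 0) :=
    Finset.sum_congr rfl fun x hx => by
      rw [Function.update_of_ne (Finset.ne_of_mem_erase hx)]
  rw [this, Function.update_self]
  simp only [eq_comm (a := j)]
  omega

/-- Every tuple is in an admissible group or in the group `m` of unassigned tuples. -/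
def Valid (n m : ℕ) (adm : ℕ → ℕ → Prop) (w : ℕ → ℕ) : Prop :=
  ∀ i < n, w i ≤ m ∧ (w i < m → adm i (w i))

/-- `y` does not decrease when an assigned tuple moves. -/
def Feasible (n m : ℕ) (adm : ℕ → ℕ → Prop) (w : ℕ → ℕ) (y : ℕ → ℚ) : Prop :=
  ∀ i < n, w i < m → ∀ k < m, adm i k → y (w i) ≤ y k

/-- A potential certifying that `w` is closest to `μ`. -/
def IsPotential (n m : ℕ) (adm : ℕ → ℕ → Prop) (μ : ℕ → ℚ) (w : ℕ → ℕ) (y : ℕ → ℚ) : Prop :=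
  Feasible n m adm w y ∧
    ∀ k < m, (cnt n w k : ℚ) - μ k - 1 ≤ y k ∧ y k ≤ (cnt n w k : ℚ) - μ k

/-- State of the search for augmentations of `w`: for each reached group `k` in `M` the assignment
`V k` has one more tuple in `k` and one unassigned tuple less. -/
structure Search (n m : ℕ) (adm : ℕ → ℕ → Prop) (w : ℕ → ℕ) (M : Finset ℕ) (V : ℕ → ℕ → ℕ) :
    Prop where
  subset : M ⊆ Finset.range (m + 1)
  source_mem : m ∈ M
  source : ∀ i < n, V m i = w i
  fixed : ∀ k ∈ M, ∀ i < n, w i = k → V k i = k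
  valid : ∀ k ∈ M, Valid n m adm (V k)
  count : ∀ k ∈ M, ∀ j, cnt n (V k) j + (if j = m then 1 else 0)
    = cnt n w j + (if j = k then 1 else 0)
  moved : ∀ k ∈ M, ∀ i < n, V k i ≠ w i → V k i < m ∧ V k i ∈ M ∧ w i ∈ M ∧
    ∀ y, Feasible n m adm w y → y (V k i) ≤ y k

variable {n m : ℕ} {adm : ℕ → ℕ → Prop} {w : ℕ → ℕ} {M : Finset ℕ} {V : ℕ → ℕ → ℕ}

theorem search_init (hw : Valid n m adm w) (hV : ∀ i < n, V m i = w i) :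
    Search n m adm w {m} V where
  subset := by simp
  source_mem := by simp
  source := hV
  fixed := by
    simp only [Finset.mem_singleton]
    rintro k rfl i hi h
    rw [hV i hi, h]
  valid := by
    simp only [Finset.mem_singleton]
    rintro k rfl i hi
    rw [hV i hi]
    exact hw i hi
  count := by
    simp only [Finset.mem_singleton]
    rintro k rfl j
    rw [cnt_congr hV]
  moved := by
    simp only [Finset.mem_singleton]
    rintro k rfl i hi h
    exact absurd (hV i hi) h

/-- On top of `V (w i)`, which has a surplus tuple in the group `w i`, tuple `i` moves on to `k`,
and the surplus moves with it. Potentials do not decrease along the path, so tuples moved earlier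
satisfy the bound for `k` as well. -/
theorem Search.step (h : Search n m adm w M V) {i k : ℕ} (hi : i < n) (hk : k < m)
    (hg : w i ∈ M) (hkM : k ∉ M) (ha : adm i k) {V' : ℕ → ℕ → ℕ}
    (hV' : ∀ l ∈ M, ∀ x < n, V' l x = V l x)
    (hk' : ∀ x < n, V' k x = Function.update (V (w i)) i k x) :
    Search n m adm w (insert k M) V' := by
  -- Tuple `i` has not been moved yet, so it is still available in its group.
  have hVg : V (w i) i = w i := h.fixed _ hg i hi rfl
  have hkg : w i ≠ k := fun e => hkM (e ▸ hg)
  have hstay : ∀ x < n, w x = k → V (w i) x = w x := fun x hx e => by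
    by_contra hne
    exact hkM (e ▸ (h.moved _ hg x hx hne).2.2.1)
  refine ⟨?_, ?_, ?_, ?_, ?_, ?_, ?_⟩
  · exact Finset.insert_subset (by simp; omega) h.subset
  · exact Finset.mem_insert_of_mem h.source_mem
  · exact fun x hx => (hV' m h.source_mem x hx).trans (h.source x hx)
  · intro l hl x hx e
    rcases Finset.mem_insert.mp hl with rfl | hl
    · rw [hk' x hx]
      rcases eq_or_ne x i with rfl | hxi
      · simp
      · rw [Function.update_of_ne hxi, hstay x hx e, e]
    · rw [hV' l hl x hx, h.fixed l hl x hx e]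
  · intro l hl x hx
    rcases Finset.mem_insert.mp hl with rfl | hl
    · rw [hk' x hx]
      rcases eq_or_ne x i with rfl | hxi
      · simpa using ⟨hk.le, fun _ => ha⟩
      · rw [Function.update_of_ne hxi]
        exact h.valid _ hg x hx
    · rw [hV' l hl x hx]
      exact h.valid l hl x hx
  · intro l hl j
    rcases Finset.mem_insert.mp hl with rfl | hl
    · rw [cnt_congr hk']
      have h1 := cnt_update (V (w i)) hi l j
      have h2 := h.count _ hg j
      rw [hVg] at h1
      omega
    · rw [cnt_congr (hV' l hl)]
      exact h.count l hl j
  · intro l hl x hx hne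
    rcases Finset.mem_insert.mp hl with rfl | hl
    · rw [hk' x hx] at hne ⊢
      rcases eq_or_ne x i with rfl | hxi
      · simpa using ⟨hk, Or.inr hg⟩
      · rw [Function.update_of_ne hxi] at hne ⊢
        obtain ⟨h1, h2, h3, h4⟩ := h.moved _ hg x hx hne
        -- Feasibility says nothing about unassigned tuples; but `V m` moves no tuple, so here the
        -- group of `i` is a real one.
        have hgm : w i < m := by
          refine lt_of_le_of_ne (by simpa [Nat.lt_succ_iff] using h.subset hg) fun e => hne ?_
          rw [e, h.source x hx]
        exact ⟨h1, Finset.mem_insert_of_mem h2, Finset.mem_insert_of_mem h3, fun y hy =>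
          (h4 y hy).trans (hy i hi hgm l hk ha)⟩
    · rw [hV' l hl x hx] at hne ⊢
      obtain ⟨h1, h2, h3, h4⟩ := h.moved l hl x hx hne
      exact ⟨h1, Finset.mem_insert_of_mem h2, Finset.mem_insert_of_mem h3, h4⟩

/-- Augmenting to a reached group of least excess preserves optimality. -/
theorem Search.exists_isPotential {μ : ℕ → ℚ} (h : Search n m adm w M V)
    (hclosed : ∀ i < n, w i ∈ M → ∀ k < m, adm i k → k ∈ M) {b : ℕ} (hb : b < m) (hbM : b ∈ M)
    (hmin : ∀ k < m, k ∈ M → (cnt n w b : ℚ) - μ b ≤ (cnt n w k : ℚ) - μ k) {y : ℕ → ℚ}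
    (hy : IsPotential n m adm μ w y) : ∃ y', IsPotential n m adm μ (V b) y' := by
  classical
  set v : ℚ := (cnt n w b : ℚ) - μ b with hv
  -- The potential is raised to the old excess `v` of `b` on the reached groups. At `b` it becomes
  -- exactly `v`, the lower end of the new interval; elsewhere in `M` it fits because `b` has least
  -- excess.
  refine ⟨fun k => if k ∈ M then max (y k) v else y k, ?_, ?_⟩
  · intro i hi hVi k hk ha
    dsimp only
    by_cases hne : V b i = w i
    · rw [hne] at hVi ⊢
      have h1 := hy.1 i hi hVi k hk ha
      by_cases hwM : w i ∈ M
      · rw [if_pos hwM, if_pos (hclosed i hi hwM k hk ha)]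
        exact max_le_max h1 le_rfl
      · rw [if_neg hwM]
        split_ifs
        · exact h1.trans (le_max_left _ _)
        · exact h1
    -- A moved tuple is in a group whose old potential is at most `y b ≤ v`, so its new potential is
    -- `v`, a lower bound for the new potential on all of `M`.
    · obtain ⟨-, h2, h3, h4⟩ := h.moved b hbM i hi hne
      rw [if_pos h2, if_pos (hclosed i hi h3 k hk ha)]
      exact max_le (((h4 y hy.1).trans (hy.2 b hb).2).trans (le_max_right _ _)) (le_max_right _ _)
  · intro k hk
    dsimp only
    have hc := h.count b hbM k
    rw [if_neg hk.ne, add_zero] at hc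
    obtain ⟨h1, h2⟩ := hy.2 k hk
    rcases eq_or_ne k b with rfl | hkb
    · rw [if_pos rfl] at hc
      rw [if_pos hbM, max_eq_right h2, hc]
      push_cast
      constructor <;> linarith
    · rw [if_neg hkb, add_zero] at hc
      rw [hc]
      split_ifs with hkM
      · exact ⟨h1.trans (le_max_left _ _), max_le h2 (hmin k hk hkM)⟩
      · exact ⟨h1, h2⟩

end Assign

/-- Double counting. It turns the linear term of the cost estimate into a sum over tuples, and for
`y = 1` it shows that all assignments have the same total count. -/
theorem sum_groupCount_mul {n m : ℕ} (w : Fin n → Fin m) (y : Fin m → ℝ) :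
    ∑ j, (groupCount w j : ℝ) * y j = ∑ i, y (w i) := by
  simp_rw [groupCount, Finset.card_filter, Nat.cast_sum, Finset.sum_mul]
  rw [Finset.sum_comm]
  simp

/-- Assignments with a potential are closest to `μ`. -/
theorem sqDist_le_of_potential {n m : ℕ} (w v : Fin n → Fin m) (μ y : Fin m → ℝ)
    (h1 : ∀ j, groupCount w j - μ j - 1 ≤ y j) (h2 : ∀ j, y j ≤ groupCount w j - μ j)
    (h3 : ∀ i, y (w i) ≤ y (v i)) :
    sqDist (toRealVec (groupCount w)) μ ≤ sqDist (toRealVec (groupCount v)) μ := by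
  -- For integers, `(c + d - μ) ^ 2 - (c - μ) ^ 2 = 2 * d * (c - μ) + d ^ 2 ≥ (2 * y + 1) * d`: the
  -- upper bound on `y` serves for `d ≥ 0`, the lower bound for `d < 0`, and `|d| ≤ d ^ 2` in both
  -- cases.
  have key : ∀ j, (toRealVec (groupCount w) j - μ j) ^ 2
      + 2 * (groupCount v j * y j - groupCount w j * y j)
      + ((groupCount v j : ℝ) * 1 - groupCount w j * 1)
      ≤ (toRealVec (groupCount v) j - μ j) ^ 2 := by
    intro j
    simp only [toRealVec]
    have h1 := h1 j
    have h2 := h2 j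
    rcases le_or_gt (groupCount w j) (groupCount v j) with h | h
    · obtain ⟨d, hd⟩ := Nat.exists_eq_add_of_le h
      rw [hd]
      push_cast
      have hd0 : (0 : ℝ) ≤ d := d.cast_nonneg
      have hd1 : (d : ℝ) ≤ d ^ 2 := by exact_mod_cast Nat.le_self_pow two_ne_zero d
      nlinarith [mul_nonneg hd0 (sub_nonneg.mpr h2)]
    · obtain ⟨d, hd⟩ := Nat.exists_eq_add_of_le h.le
      rw [hd] at h1 ⊢
      push_cast at h1 ⊢
      have hd0 : (0 : ℝ) ≤ d := d.cast_nonneg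
      have hd1 : (d : ℝ) ≤ d ^ 2 := by exact_mod_cast Nat.le_self_pow two_ne_zero d
      nlinarith [mul_nonneg hd0 (sub_nonneg.mpr h1)]
  have hsum := Finset.sum_le_sum fun j (_ : j ∈ Finset.univ) => key j
  simp only [Finset.sum_add_distrib, ← Finset.mul_sum, Finset.sum_sub_distrib] at hsum
  rw [sum_groupCount_mul, sum_groupCount_mul, sum_groupCount_mul v fun _ => 1,
    sum_groupCount_mul w fun _ => 1] at hsum
  have : ∑ i, y (w i) ≤ ∑ i, y (v i) := Finset.sum_le_sum fun i _ => h3 i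
  unfold sqDist
  linarith

/-! ### Expected distance and the mean answer. -/

namespace ProbRel

variable {n m : ℕ} (P : ProbRel n m)

/-- Insert the indicator into the factor of tuple `i` and expand the product of sums; every other
factor sums to 1. -/
theorem expect_ite_eq (i : Fin n) (j : Fin m) :
    (P.expect fun w => if w i = j then 1 else 0) = P.prob i j := by
  have h : ∏ a, ∑ b, (P.prob a b : ℝ) * (if a = i then if b = j then 1 else 0 else 1)
      = P.prob i j := by
    rw [Finset.prod_eq_single i]
    · simp
    · intro a _ ha
      simp only [if_neg ha, mul_one]
      exact_mod_cast P.sum_eq_one a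
    · simp
  rw [← h, Finset.prod_univ_sum, Fintype.piFinset_univ]
  refine Finset.sum_congr rfl fun w _ => ?_
  rw [worldProb, Finset.prod_mul_distrib]
  simp

theorem meanAnswer_eq (j : Fin m) : P.meanAnswer j = ∑ i, (P.prob i j : ℝ) := by
  simp_rw [← P.expect_ite_eq, meanAnswer, expect, groupCount, Finset.card_filter]
  rw [Finset.sum_comm]
  refine Finset.sum_congr rfl fun w _ => ?_
  rw [← Finset.mul_sum]
  push_cast
  rfl

/-- Bias-variance decomposition: the cross term vanishes at the mean. -/
theorem expDist_eq (x : Fin m → ℝ) :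
    P.expDist x = sqDist x P.meanAnswer + P.expDist P.meanAnswer := by
  have key : ∀ y : Fin m → ℝ, P.expDist y =
      ∑ j, (y j ^ 2 - 2 * y j * P.meanAnswer j
        + P.expect fun w => (groupCount w j : ℝ) ^ 2) := by
    intro y
    unfold expDist expect sqDist meanAnswer expect toRealVec
    simp_rw [Finset.mul_sum]
    rw [Finset.sum_comm]
    refine Finset.sum_congr rfl fun j _ => ?_
    have h1 : y j ^ 2 = ∑ w, P.worldProb w * y j ^ 2 := by
      rw [← Finset.sum_mul, P.sum_worldProb, one_mul]
    rw [h1, ← Finset.sum_sub_distrib, ← Finset.sum_add_distrib]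
    exact Finset.sum_congr rfl fun w _ => by ring
  rw [key, key, sqDist, ← Finset.sum_add_distrib]
  exact Finset.sum_congr rfl fun j _ => by ring

theorem expDist_nonneg (x : Fin m → ℝ) : 0 ≤ P.expDist x :=
  Finset.sum_nonneg fun w _ => mul_nonneg (P.worldProb_nonneg w)
    (Finset.sum_nonneg fun _ _ => sq_nonneg _)

/-- A possible answer closest to the mean answer is itself a median answer. -/
theorem IsClosestToMean.isApproxMedianAnswer {P : ProbRel n m} {a : Fin m → ℕ}
    (h : P.IsClosestToMean a) : P.IsApproxMedianAnswer 4 a := by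
  refine ⟨h.1, fun b hb => ?_⟩
  have h1 := h.2 b hb.1
  have h2 := P.expDist_eq (toRealVec a)
  have h3 := P.expDist_eq (toRealVec b)
  -- The first three facts give factor 1; nonnegativity weakens it to 4.
  have h4 := P.expDist_nonneg (toRealVec b)
  linarith

theorem worldProb_pos_iff (w : Fin n → Fin m) : 0 < P.worldProb w ↔ ∀ i, 0 < P.prob i (w i) := by
  refine ⟨fun h i => lt_of_le_of_ne (P.nonneg _ _) fun e => h.ne' ?_, fun h =>
    Finset.prod_pos fun i _ => by exact_mod_cast h i⟩
  exact Finset.prod_eq_zero (Finset.mem_univ i) (by rw [← e]; simp)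

theorem isClosestToMean_of_potential (w : Fin n → Fin m) (hw : ∀ i, 0 < P.prob i (w i))
    (y : Fin m → ℝ) (h1 : ∀ j, groupCount w j - ∑ i, (P.prob i j : ℝ) - 1 ≤ y j)
    (h2 : ∀ j, y j ≤ groupCount w j - ∑ i, (P.prob i j : ℝ))
    (h3 : ∀ i k, 0 < P.prob i k → y (w i) ≤ y k) : P.IsClosestToMean (groupCount w) := by
  refine ⟨⟨w, (P.worldProb_pos_iff w).mpr hw, rfl⟩, ?_⟩
  rintro _ ⟨v, hv, rfl⟩
  have hv := (P.worldProb_pos_iff v).mp hv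
  refine sqDist_le_of_potential w v _ y ?_ ?_ fun i => h3 i _ (hv i)
  · simpa only [meanAnswer_eq] using h1
  · simpa only [meanAnswer_eq] using h2

end ProbRel

namespace RAM

open Assign

theorem natAbs_cast_lt_two_pow {k U : ℕ} (h : k ≤ U) : ((k : ℤ)).natAbs < 2 ^ U := by
  simpa using h.trans_lt Nat.lt_two_pow_self

/-! ### Copying rows -/

/-- Copy the first `reg 0` entries of row `reg a` of array `4` to row `reg b`. -/
def copyRow (a b : ℕ) : Prog :=
  .forTo 7 0 (.put 4 (.reg b) (.reg 7) (.get 4 (.reg a) (.reg 7)))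

theorem WP.copyRow {U n a b ka kb : ℕ} {s : State} (hn : s.reg 0 = n) (hnU : n ≤ U) (ha : a < 7)
    (hb : b < 7) (hka : s.reg a = ka) (hkb : s.reg b = kb) :
    WP U (copyRow a b) (fun s' => Frame 7 s s' ∧ ∀ r k i, s'.get r k i =
      if r = 4 ∧ k = kb ∧ i < n then s.get 4 ka i else s.get r k i) s := by
  refine WP.forTo (fun h s' => Frame 7 s s' ∧ ∀ r k i, s'.get r k i =
    if r = 4 ∧ k = kb ∧ i < h then s.get 4 ka i else s.get r k i) (by norm_num) hn hnU
    ⟨(Frame.refl _ _).setReg le_rfl _, by simp⟩ ?_ fun s' h _ _ => h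
  intro h hh s' ⟨hf, hg⟩ h7 h0
  refine WP.of_bounded fun hs => WP.put (k := kb) (i := h) (v := s.get 4 ka h) ?_ h7 ?_ ?_ ?_
  · exact (hf.1 b hb).trans hkb
  · rw [Expr.eval_get (ek := .reg a) (ei := .reg 7) ((hf.1 a ha).trans hka) h7, hg]
    split_ifs <;> rfl
  · have := hs.get 4 ka h
    rw [hg] at this
    split_ifs at this <;> exact this
  · refine ⟨h7, h0, (hf.put _ _ _ _).setReg le_rfl _, fun r k i => ?_⟩
    rw [State.setReg_get, State.put_get, hg]
    by_cases h1 : r = 4 ∧ k = kb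
    · obtain ⟨rfl, rfl⟩ := h1
      rcases lt_trichotomy i h with h2 | rfl | h2
      · simp [h2, h2.ne, Nat.lt_succ_of_lt h2]
      · simp
      · simp [h2.ne', h2.not_gt, show ¬ i < h + 1 by omega]
    · rw [if_neg (by tauto), if_neg (by tauto), if_neg (by tauto)]

/-! ### Searching for augmentations -/

/-- The machine holds the sizes `n`, `m` and the rational numbers `q i j`. -/
structure Input (n m : ℕ) (q : ℕ → ℕ → ℚ) (s : State) : Prop where
  reg_zero : s.reg 0 = n
  reg_one : s.reg 1 = m
  num : ∀ i < n, ∀ j < m, s.mem (2 * ((i : ℤ) * m + j)) = (q i j).num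
  den : ∀ i < n, ∀ j < m, s.mem (2 * ((i : ℤ) * m + j) + 1) = (q i j).den

theorem Input.frame {n m d : ℕ} {q : ℕ → ℕ → ℚ} {s s' : State} (h : Input n m q s)
    (hf : Frame d s s') (hd : 2 ≤ d) : Input n m q s' where
  reg_zero := (hf.1 0 (by omega)).trans h.reg_zero
  reg_one := (hf.1 1 (by omega)).trans h.reg_one
  num i hi j hj := (hf.2 _ (by positivity)).trans (h.num i hi j hj)
  den i hi j hj := (hf.2 _ (by positivity)).trans (h.den i hi j hj)

def Expr.num (i j : Expr) : Expr := .mem (.mul (.const 2) (.add (.mul i (.reg 1)) j))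

def Expr.den (i j : Expr) : Expr :=
  .mem (.add (.mul (.const 2) (.add (.mul i (.reg 1)) j)) (.const 1))

theorem Input.eval_num {n m i j : ℕ} {q : ℕ → ℕ → ℚ} {s : State} (h : Input n m q s) (hi : i < n)
    (hj : j < m) {ei ej : Expr} (hei : ei.eval s = i) (hej : ej.eval s = j) :
    (Expr.num ei ej).eval s = (q i j).num := by
  rw [← h.num i hi j hj]
  simp [Expr.num, Expr.eval, hei, hej, h.reg_one]

theorem Input.eval_den {n m i j : ℕ} {q : ℕ → ℕ → ℚ} {s : State} (h : Input n m q s) (hi : i < n)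
    (hj : j < m) {ei ej : Expr} (hei : ei.eval s = i) (hej : ej.eval s = j) :
    (Expr.den ei ej).eval s = (q i j).den := by
  rw [← h.den i hi j hj]
  simp [Expr.den, Expr.eval, hei, hej, h.reg_one]

/-- Group `j` is admissible for tuple `i`. -/
def Adm (q : ℕ → ℕ → ℚ) (i j : ℕ) : Prop := 0 < q i j

/-- The search with reached groups `M` is represented by the marks in array `3` and the
assignments in array `4`. -/
def Searching (n m : ℕ) (q : ℕ → ℕ → ℚ) (w : ℕ → ℕ) (M : Finset ℕ) (s : State) : Prop :=
  Input n m q s ∧ ∃ V, Search n m (Adm q) w M V ∧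
    (∀ k ≤ m, s.get 3 k k = if k ∈ M then 1 else 0) ∧
    ∀ k ∈ M, ∀ i < n, s.get 4 k i = V k i

/-- A frame in which moreover the arrays `0`, `1`, `2` are unchanged. -/
def Frame' (d : ℕ) (s s' : State) : Prop :=
  Frame d s s' ∧ ∀ r < 3, ∀ k i, s'.get r k i = s.get r k i

theorem Frame'.refl (d : ℕ) (s : State) : Frame' d s s := ⟨Frame.refl d s, fun _ _ _ _ => rfl⟩

theorem Frame'.trans {d : ℕ} {s s' s'' : State} (h : Frame' d s s') (h' : Frame' d s' s'') :
    Frame' d s s'' :=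
  ⟨h.1.trans h'.1, fun r hr k i => (h'.2 r hr k i).trans (h.2 r hr k i)⟩

theorem Frame'.anti {d d' : ℕ} {s s' : State} (h : Frame' d s s') (hd : d' ≤ d) :
    Frame' d' s s' := ⟨h.1.anti hd, h.2⟩

theorem Frame'.setReg {d k : ℕ} {s s' : State} (h : Frame' d s s') (hk : d ≤ k) (v : ℤ) :
    Frame' d s (s'.setReg k v) := ⟨h.1.setReg hk v, h.2⟩

theorem Frame'.put {d r k i : ℕ} {s s' : State} (h : Frame' d s s') (hr : 3 ≤ r) (v : ℤ) :
    Frame' d s (s'.put r k i v) :=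
  ⟨h.1.put r k i v, fun r' hr' k' i' => by
    rw [State.put_get, if_neg (by omega), h.2 r' hr']⟩

theorem Searching.setReg {n m k : ℕ} {q : ℕ → ℕ → ℚ} {w : ℕ → ℕ} {M : Finset ℕ} {s : State}
    (h : Searching n m q w M s) (hk : 2 ≤ k) (v : ℤ) : Searching n m q w M (s.setReg k v) :=
  ⟨h.1.frame ((Frame.refl k s).setReg le_rfl v) hk, h.2⟩

/-- If tuple `reg 4` can move from a reached group to the group `reg 5` not yet reached, then
reach it. -/
def scanStep : Prog :=
  .ifPos (.mul (.mul (.get 3 (.get 4 (.reg 1) (.reg 4)) (.get 4 (.reg 1) (.reg 4)))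
      (.sub (.const 1) (.get 3 (.reg 5) (.reg 5)))) (.num (.reg 4) (.reg 5)))
    (.seq (.set 6 (.get 4 (.reg 1) (.reg 4)))
      (.seq (copyRow 6 5)
        (.seq (.put 4 (.reg 5) (.reg 4) (.reg 5)) (.put 3 (.reg 5) (.reg 5) (.const 1)))))
    .skip

/-- The test multiplies two values in `{0, 1}` by a numerator, so it is positive exactly when `w i`
is reached, `k` is not, and `k` is admissible. The group `w i` is read from row `m`, which holds the
unmodified assignment. -/
theorem WP.scanStep {U n m i k : ℕ} {q : ℕ → ℕ → ℚ} {w : ℕ → ℕ} {M : Finset ℕ} {s : State}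
    (hnU : n ≤ U) (hmU : m ≤ U) (hw : Valid n m (Adm q) w) (h : Searching n m q w M s) (hi : i < n)
    (hk : k < m) (h4 : s.reg 4 = i) (h5 : s.reg 5 = k) :
    WP U scanStep (fun s' => Frame' 6 s s' ∧ ∃ M', Searching n m q w M' s' ∧
      ((w i ∈ M ∧ k ∉ M ∧ Adm q i k ∧ M' = insert k M) ∨
        ((w i ∈ M → Adm q i k → k ∈ M) ∧ M' = M))) s := by
  obtain ⟨hin, V, hS, hmark, hrow⟩ := h
  have hwi : (Expr.get 4 (.reg 1) (.reg 4)).eval s = w i := by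
    rw [Expr.eval_get (ek := .reg 1) (ei := .reg 4) hin.reg_one h4, hrow m hS.source_mem i hi,
      hS.source i hi]
  have htest : (Expr.mul (.mul (.get 3 (.get 4 (.reg 1) (.reg 4)) (.get 4 (.reg 1) (.reg 4)))
      (.sub (.const 1) (.get 3 (.reg 5) (.reg 5)))) (.num (.reg 4) (.reg 5))).eval s
      = (if w i ∈ M then 1 else 0) * (1 - if k ∈ M then 1 else 0) * (q i k).num := by
    simp only [Expr.eval]
    rw [Expr.eval_get hwi hwi, Expr.eval_get (ek := .reg 5) (ei := .reg 5) h5 h5, hin.eval_num hi hk (ei := .reg 4) (ej := .reg 5) h4 h5,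
      hmark _ (hw i hi).1, hmark _ hk.le]
  refine WP.ifPos (fun hpos => ?_) fun hneg => WP.skip ?_
  · rw [htest] at hpos
    have hwM : w i ∈ M := by
      by_contra hc
      simp [hc] at hpos
    have hkM : k ∉ M := by
      intro hc
      simp [hc] at hpos
    have ha : Adm q i k := by
      simpa [hwM, hkM, Rat.num_pos, Adm] using hpos
    refine WP.seq (WP.set (by rw [hwi]; exact natAbs_cast_lt_two_pow ((hw i hi).1.trans hmU)) ?_)
    rw [hwi]
    refine WP.seq ((WP.copyRow (ka := w i) (kb := k) (n := n) (by simpa using hin.reg_zero) hnU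
      (by norm_num) (by norm_num) (by simp) (by simpa using h5)).mono fun s1 ⟨hf, hg⟩ => ?_)
    have g5 : s1.reg 5 = k := by rw [hf.1 5 (by norm_num)]; simpa using h5
    have g4 : s1.reg 4 = i := by rw [hf.1 4 (by norm_num)]; simpa using h4
    refine WP.seq (WP.put g5 g4 g5 (natAbs_cast_lt_two_pow (hk.le.trans hmU)) ?_)
    refine WP.put (v := 1) (k := k) (i := k) g5 g5 rfl
      (by simpa using natAbs_cast_lt_two_pow (k := 1) (U := U) (by omega)) ?_
    have hF : Frame' 6 s s1 := by
      refine ⟨⟨fun l hl => ?_, hf.2⟩, fun r hr x y => ?_⟩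
      · rw [hf.1 l (by omega), State.setReg_reg_of_ne _ _ (by omega)]
      · rw [hg, if_neg (by omega), State.setReg_get]
    have hF' := (hF.put (r := 4) (k := k) (i := i) (by norm_num) k).put (r := 3) (k := k) (i := k)
      le_rfl 1
    refine ⟨hF', insert k M, ⟨hin.frame hF'.1 (by norm_num),
      fun l x => if l = k then Function.update (V (w i)) i k x else V l x,
      hS.step hi hk hwM hkM ha ?_ ?_, ?_, ?_⟩, Or.inl ⟨hwM, hkM, ha, rfl⟩⟩
    · intro l hl x _
      exact if_neg fun e : l = k => hkM (e ▸ hl)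
    · intro x _
      exact if_pos rfl
    · intro l hl
      rw [State.put_get]
      by_cases hlk : l = k
      · simp [hlk]
      · rw [if_neg (by tauto), State.put_get, if_neg (by omega), hg, if_neg (by omega),
          State.setReg_get, hmark l hl]
        simp [hlk]
    · intro l hl x hx
      rw [State.put_get, if_neg (by omega), State.put_get]
      dsimp only
      by_cases hlk : l = k
      · subst hlk
        rw [if_pos rfl]
        by_cases hxi : x = i
        · simp [hxi]
        · rw [if_neg (by tauto), Function.update_of_ne hxi, hg, if_pos ⟨rfl, rfl, hx⟩,
            State.setReg_get, hrow _ hwM x hx]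
      · rw [if_neg (by tauto), if_neg hlk, hg, if_neg (by tauto), State.setReg_get,
          hrow l (Finset.mem_of_mem_insert_of_ne hl hlk) x hx]
  · refine ⟨Frame'.refl _ _, M, ⟨hin, V, hS, hmark, hrow⟩, Or.inr ⟨fun hwM ha => ?_, rfl⟩⟩
    by_contra hkM
    refine hneg ?_
    rw [htest]
    simpa [hwM, hkM, Rat.num_pos, Adm] using ha

/-- Progress of the search in a round that started with at least `c` reached groups (or complete),
after scanning all pairs up to tuple `i` and group `k`. -/
def Progress (n m : ℕ) (adm : ℕ → ℕ → Prop) (w : ℕ → ℕ) (c i k : ℕ) (M : Finset ℕ) : Prop :=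
  (c ≤ M.card ∨ ∀ i < n, w i ∈ M → ∀ k < m, adm i k → k ∈ M) ∧
    (c + 1 ≤ M.card ∨ (∀ i' < i, w i' ∈ M → ∀ k' < m, adm i' k' → k' ∈ M) ∧
      ∀ k' < k, w i ∈ M → adm i k' → k' ∈ M)

namespace Progress

variable {n m c i k : ℕ} {adm : ℕ → ℕ → Prop} {w : ℕ → ℕ} {M M' : Finset ℕ}

/-- An insertion shows that `M` was not closed, so it had at least `c` elements and now has `c + 1`.
Without one, `M` is unchanged and the pairs scanned so far stay closed. -/
theorem step (h : Progress n m adm w c i k M) (hi : i < n) (hk : k < m)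
    (hM : (w i ∈ M ∧ k ∉ M ∧ adm i k ∧ M' = insert k M) ∨
      ((w i ∈ M → adm i k → k ∈ M) ∧ M' = M)) : Progress n m adm w c i (k + 1) M' := by
  rcases hM with ⟨h1, h2, h3, rfl⟩ | ⟨h1, rfl⟩
  · have hc : c ≤ M.card := h.1.resolve_right fun hcl => h2 (hcl i hi h1 k hk h3)
    have := Finset.card_insert_of_notMem h2
    exact ⟨Or.inl (by omega), Or.inl (by omega)⟩
  · refine ⟨h.1, h.2.imp_right fun ⟨g1, g2⟩ => ⟨g1, fun k' hk' => ?_⟩⟩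
    rcases Nat.lt_succ_iff_lt_or_eq.mp hk' with hk' | rfl
    exacts [g2 k' hk', h1]

theorem next_row (h : Progress n m adm w c i m M) : Progress n m adm w c (i + 1) 0 M := by
  refine ⟨h.1, h.2.imp_right fun ⟨g1, g2⟩ => ⟨fun i' hi' => ?_, by simp⟩⟩
  rcases Nat.lt_succ_iff_lt_or_eq.mp hi' with hi' | rfl
  · exact g1 i' hi'
  · exact fun hw k' hk' => g2 k' hk' hw

theorem next_round (h : Progress n m adm w c n 0 M) : Progress n m adm w (c + 1) 0 0 M :=
  ⟨h.2.imp_right fun g => g.1, Or.inr (by simp)⟩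

/-- With `m + 1` elements, `M` contains every group. -/
theorem closed (h : Progress n m adm w (m + 1) 0 0 M) (hM : M ⊆ Finset.range (m + 1)) :
    ∀ i < n, w i ∈ M → ∀ k < m, adm i k → k ∈ M := by
  refine h.1.elim (fun hc => ?_) id
  have := Finset.eq_of_subset_of_card_le hM (by simpa using hc)
  intro i _ _ k hk _
  rw [this]
  simp
  omega

end Progress

/-- Repeat scanning all pairs of a tuple and a group, as often as there are groups. -/
def search : Prog := .forTo 3 1 (.forTo 4 0 (.forTo 5 1 scanStep))

section

variable {U n m : ℕ} {q : ℕ → ℕ → ℚ} {w : ℕ → ℕ} {M : Finset ℕ} {s : State}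

theorem WP.scanRow {c i : ℕ} (hnU : n ≤ U) (hmU : m ≤ U) (hw : Valid n m (Adm q) w) (hi : i < n)
    (h4 : s.reg 4 = i) (hM : Searching n m q w M s) (hP : Progress n m (Adm q) w c i 0 M) :
    WP U (.forTo 5 1 RAM.scanStep) (fun s' => Frame' 5 s s' ∧ ∃ M', Searching n m q w M' s' ∧
      Progress n m (Adm q) w c (i + 1) 0 M') s := by
  refine WP.forTo (fun k s' => Frame' 5 s s' ∧ ∃ M', Searching n m q w M' s' ∧
    Progress n m (Adm q) w c i k M') (by norm_num) hM.1.reg_one hmU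
    ⟨(Frame'.refl _ _).setReg le_rfl _, M, hM.setReg (by norm_num) _, hP⟩ ?_
    fun s' ⟨hf, M', h1, h2⟩ _ _ => ⟨hf, M', h1, h2.next_row⟩
  intro k hk s1 ⟨hf, M1, hM1, hP1⟩ h5 h1
  have h4' : s1.reg 4 = i := (hf.1.1 4 (by norm_num)).trans h4
  refine (WP.scanStep hnU hmU hw hM1 hi hk h4' h5).mono fun s2 ⟨hf2, M2, hM2, hstep⟩ => ?_
  exact ⟨(hf2.1.1 5 (by norm_num)).trans h5, (hf2.1.1 1 (by norm_num)).trans h1,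
    (hf.trans (hf2.anti (by norm_num))).setReg le_rfl _, M2, hM2.setReg (by norm_num) _,
    hP1.step hi hk hstep⟩

theorem WP.scanRound {c : ℕ} (hnU : n ≤ U) (hmU : m ≤ U) (hw : Valid n m (Adm q) w)
    (hM : Searching n m q w M s) (hP : Progress n m (Adm q) w c 0 0 M) :
    WP U (.forTo 4 0 (.forTo 5 1 RAM.scanStep)) (fun s' => Frame' 4 s s' ∧
      ∃ M', Searching n m q w M' s' ∧ Progress n m (Adm q) w (c + 1) 0 0 M') s := by
  refine WP.forTo (fun i s' => Frame' 4 s s' ∧ ∃ M', Searching n m q w M' s' ∧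
    Progress n m (Adm q) w c i 0 M') (by norm_num) hM.1.reg_zero hnU
    ⟨(Frame'.refl _ _).setReg le_rfl _, M, hM.setReg (by norm_num) _, hP⟩ ?_
    fun s' ⟨hf, M', h1, h2⟩ _ _ => ⟨hf, M', h1, h2.next_round⟩
  intro i hi s1 ⟨hf, M1, hM1, hP1⟩ h4 h0
  refine (WP.scanRow hnU hmU hw hi h4 hM1 hP1).mono fun s2 ⟨hf2, M2, hM2, hP2⟩ => ?_
  exact ⟨(hf2.1.1 4 (by norm_num)).trans h4, (hf2.1.1 0 (by norm_num)).trans h0,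
    (hf.trans (hf2.anti (by norm_num))).setReg le_rfl _, M2, hM2.setReg (by norm_num) _, hP2⟩

theorem WP.search (hnU : n ≤ U) (hmU : m ≤ U) (hw : Valid n m (Adm q) w)
    (hM : Searching n m q w {m} s) :
    WP U search (fun s' => Frame' 3 s s' ∧ ∃ M, Searching n m q w M s' ∧
      ∀ i < n, w i ∈ M → ∀ k < m, Adm q i k → k ∈ M) s := by
  -- The group `m` is reached from the start, so `r` rounds yield `r + 1` groups or closure, and `m`
  -- rounds suffice.
  refine WP.forTo (fun r s' => Frame' 3 s s' ∧ ∃ M', Searching n m q w M' s' ∧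
    Progress n m (Adm q) w (r + 1) 0 0 M') (by norm_num) hM.1.reg_one hmU
    ⟨(Frame'.refl _ _).setReg le_rfl _, {m}, hM.setReg (by norm_num) _,
      Or.inl (by simp), Or.inr (by simp)⟩ ?_
    fun s' ⟨hf, M', h1, h2⟩ _ _ => ⟨hf, M', h1, ?_⟩
  · intro r hr s1 ⟨hf, M1, hM1, hP1⟩ h3 h1
    refine (WP.scanRound hnU hmU hw hM1 hP1).mono fun s2 ⟨hf2, M2, hM2, hP2⟩ => ?_
    exact ⟨(hf2.1.1 3 (by norm_num)).trans h3, (hf2.1.1 1 (by norm_num)).trans h1,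
      (hf.trans (hf2.anti (by norm_num))).setReg le_rfl _, M2, hM2.setReg (by norm_num) _, hP2⟩
  · obtain ⟨-, V, hS, -⟩ := h1
    exact h2.closed hS.subset

end

end RAM

namespace RAM

open Assign

/-! ### One augmentation -/

/-- The arrays `0` and `1` hold numerators and denominators of `μ`; entry `m` represents the
fraction `-1 / 0`, which makes the excess of the group `m` infinite. -/
structure Fractions (m : ℕ) (μ : ℕ → ℚ) (s : State) : Prop where
  den_pos : ∀ k < m, 0 < s.get 1 k k
  num_eq : ∀ k < m, (s.get 0 k k : ℚ) = μ k * s.get 1 k k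
  num_last : s.get 0 m m = -1
  den_last : s.get 1 m m = 0

theorem Fractions.congr {m : ℕ} {μ : ℕ → ℚ} {s s' : State} (h : Fractions m μ s)
    (hs : ∀ r < 2, ∀ k i, s'.get r k i = s.get r k i) : Fractions m μ s' := by
  have h0 := hs 0 (by norm_num)
  have h1 := hs 1 (by norm_num)
  constructor <;> simp only [h0, h1]
  exacts [h.den_pos, h.num_eq, h.num_last, h.den_last]

/-- Excess of the count of a group over its mean, times the denominator of the mean. -/
def excess (e : Expr) : Expr := .sub (.mul (.get 2 e e) (.get 1 e e)) (.get 0 e e)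

/-- Excesses are compared by cross multiplication, as the machine has no division; the leading
factor discards unmarked groups. -/
def selectTest : Expr :=
  .mul (.get 3 (.reg 4) (.reg 4)) (.sub (.mul (excess (.reg 3)) (.get 1 (.reg 4) (.reg 4)))
    (.mul (excess (.reg 4)) (.get 1 (.reg 3) (.reg 3))))

/-- Find a marked group of least excess. -/
def select : Prog :=
  .seq (.set 3 (.reg 1)) (.forTo 4 1 (.ifPos selectTest (.set 3 (.reg 4)) .skip))

theorem eval_selectTest {s : State} {b k : ℕ} (h3 : s.reg 3 = b) (h4 : s.reg 4 = k) :
    selectTest.eval s = s.get 3 k k * ((s.get 2 b b * s.get 1 b b - s.get 0 b b) * s.get 1 k k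
      - (s.get 2 k k * s.get 1 k k - s.get 0 k k) * s.get 1 b b) := by
  have hb : ∀ r, (Expr.get r (.reg 3) (.reg 3)).eval s = s.get r b b := fun r =>
    Expr.eval_get (ek := .reg 3) (ei := .reg 3) h3 h3
  have hk : ∀ r, (Expr.get r (.reg 4) (.reg 4)).eval s = s.get r k k := fun r =>
    Expr.eval_get (ek := .reg 4) (ei := .reg 4) h4 h4
  simp only [selectTest, excess, Expr.eval, hb, hk]

theorem Fractions.cross_pos_iff {m : ℕ} {μ : ℕ → ℚ} {s : State} (h : Fractions m μ s) {b k : ℕ}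
    (hb : b < m) (hk : k < m) :
    0 < (s.get 2 b b * s.get 1 b b - s.get 0 b b) * s.get 1 k k
      - (s.get 2 k k * s.get 1 k k - s.get 0 k k) * s.get 1 b b ↔
    (s.get 2 k k : ℚ) - μ k < s.get 2 b b - μ b := by
  have h1 : (0 : ℚ) < s.get 1 b b := by exact_mod_cast h.den_pos b hb
  have h2 : (0 : ℚ) < s.get 1 k k := by exact_mod_cast h.den_pos k hk
  rw [← Int.cast_pos (R := ℚ)]
  push_cast
  rw [h.num_eq b hb, h.num_eq k hk]
  have : ((s.get 2 b b : ℚ) * s.get 1 b b - μ b * s.get 1 b b) * s.get 1 k k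
      - (s.get 2 k k * s.get 1 k k - μ k * s.get 1 k k) * s.get 1 b b
      = (s.get 1 b b * s.get 1 k k) * ((s.get 2 b b - μ b) - (s.get 2 k k - μ k)) := by ring
  rw [this, mul_pos_iff_of_pos_left (mul_pos h1 h2), sub_pos]

theorem WP.select {U m : ℕ} {μ : ℕ → ℚ} {M : Finset ℕ} {s : State} (hmU : m ≤ U)
    (h1 : s.reg 1 = m) (hF : Fractions m μ s) (hmark : ∀ k ≤ m, s.get 3 k k = if k ∈ M then 1 else 0)
    (hM : ∃ k < m, k ∈ M) :
    WP U select (fun s' => Frame 3 s s' ∧ (∀ r k i, s'.get r k i = s.get r k i) ∧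
      ∃ b < m, s'.reg 3 = b ∧ b ∈ M ∧
        ∀ k < m, k ∈ M → (s.get 2 b b : ℚ) - μ b ≤ s.get 2 k k - μ k) s := by
  refine WP.seq (WP.set (by simpa [Expr.eval, h1] using natAbs_cast_lt_two_pow hmU) ?_)
  refine WP.forTo (fun k s' => Frame 3 s s' ∧ (∀ r k i, s'.get r k i = s.get r k i) ∧
    ∃ b : ℕ, s'.reg 3 = b ∧ ((b = m ∧ ∀ l < k, l ∉ M) ∨ (b < m ∧ b ∈ M ∧
        ∀ l < k, l ∈ M → (s.get 2 b b : ℚ) - μ b ≤ s.get 2 l l - μ l))) (N := m) (by norm_num)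
    (by simpa using h1) hmU
    ⟨((Frame.refl _ _).setReg le_rfl _).setReg (by norm_num) _, fun _ _ _ => rfl, m,
      by simpa [Expr.eval] using h1, Or.inl ⟨rfl, by simp⟩⟩ ?_ ?_
  · intro k hk s1 ⟨hf, hg, b, h3, hb⟩ h4 h1'
    have hmk := hmark k hk.le
    have hev := eval_selectTest h3 h4
    simp only [hg] at hev
    refine WP.ifPos (fun hpos => WP.set ?_ ?_) fun hneg => WP.skip ?_
    · simpa [Expr.eval, h4] using natAbs_cast_lt_two_pow (hk.le.trans hmU)
    · have hkM : k ∈ M := by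
        by_contra hc
        rw [hev, hmk, if_neg hc, zero_mul] at hpos
        exact lt_irrefl _ hpos
      rw [hev, hmk, if_pos hkM, one_mul] at hpos
      refine ⟨by simpa using h4, by simpa using h1',
        (hf.setReg le_rfl _).setReg (by norm_num) _, hg, k, by simpa [Expr.eval] using h4,
        Or.inr ⟨hk, hkM, fun l hl hlM => ?_⟩⟩
      rcases Nat.lt_succ_iff_lt_or_eq.mp hl with hl | rfl
      · rcases hb with ⟨-, hb⟩ | ⟨hbm, -, hb⟩
        · exact absurd hlM (hb l hl)
        · exact ((hF.cross_pos_iff hbm hk).mp hpos).le.trans (hb l hl hlM)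
      · exact le_rfl
    · refine ⟨h4, h1', hf.setReg (by norm_num) _, hg, b, by simpa using h3, ?_⟩
      rw [hev, hmk] at hneg
      rcases hb with ⟨rfl, hb⟩ | ⟨hbm, hbM, hb⟩
      · refine Or.inl ⟨rfl, fun l hl hlM => ?_⟩
        rcases Nat.lt_succ_iff_lt_or_eq.mp hl with hl | rfl
        · exact hb l hl hlM
        -- Against the sentinel `-1 / 0` the test reduces to the denominator of `l`, which is
        -- positive, so the first marked group always replaces it.
        · rw [if_pos hlM, hF.num_last, hF.den_last] at hneg
          simp only [mul_zero, sub_zero, one_mul, zero_sub, neg_neg] at hneg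
          exact hneg (hF.den_pos l hk)
      · refine Or.inr ⟨hbm, hbM, fun l hl hlM => ?_⟩
        rcases Nat.lt_succ_iff_lt_or_eq.mp hl with hl | rfl
        · exact hb l hl hlM
        · rw [if_pos hlM, one_mul, hF.cross_pos_iff hbm hk] at hneg
          exact not_lt.mp hneg
  · rintro s1 ⟨hf, hg, b, h3, ⟨-, hb⟩ | ⟨hbm, hbM, hb⟩⟩ - -
    · obtain ⟨k, hk, hkM⟩ := hM
      exact absurd hkM (hb k hk)
    · exact ⟨hf, hg, b, hbm, h3, hbM, hb⟩

/-- The current assignment is row `m` of array `4`; it leaves `u` tuples unassigned, its counts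
are in array `2`, and it has a potential. -/
def Solved (n m : ℕ) (q : ℕ → ℕ → ℚ) (μ : ℕ → ℚ) (u : ℕ) (s : State) : Prop :=
  Input n m q s ∧ Fractions m μ s ∧ s.get 3 m m = 1 ∧ ∃ w : ℕ → ℕ,
    (∀ i < n, s.get 4 m i = w i) ∧ (∀ k < m, s.get 2 k k = cnt n w k) ∧ Valid n m (Adm q) w ∧
    cnt n w m = u ∧ ∃ y, IsPotential n m (Adm q) μ w y

theorem Solved.setReg {n m u k : ℕ} {q : ℕ → ℕ → ℚ} {μ : ℕ → ℚ} {s : State}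
    (h : Solved n m q μ u s) (hk : 2 ≤ k) (v : ℤ) : Solved n m q μ u (s.setReg k v) :=
  ⟨h.1.frame ((Frame.refl k s).setReg le_rfl v) hk, ⟨h.2.1.1, h.2.1.2, h.2.1.3, h.2.1.4⟩, h.2.2⟩

/-- The mark of group `m`, where every search starts, is kept. -/
def clearMarks : Prog := .forTo 4 1 (.put 3 (.reg 4) (.reg 4) (.const 0))

theorem WP.clearMarks {U m : ℕ} {s : State} (h1 : s.reg 1 = m) (hmU : m ≤ U) :
    WP U clearMarks (fun s' => Frame 3 s s' ∧ ∀ r k i, s'.get r k i =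
      if r = 3 ∧ k < m ∧ i = k then 0 else s.get r k i) s := by
  refine WP.forTo (fun j s' => Frame 3 s s' ∧ ∀ r k i, s'.get r k i =
    if r = 3 ∧ k < j ∧ i = k then 0 else s.get r k i) (by norm_num) h1 hmU
    ⟨(Frame.refl _ _).setReg (by norm_num) _, by simp⟩ ?_ fun s' h _ _ => h
  intro j hj s1 ⟨hf, hg⟩ h4 h1'
  refine WP.put (k := j) (i := j) (v := 0) h4 h4 rfl (by simp)
    ⟨h4, h1', (hf.put _ _ _ _).setReg (by norm_num) _, fun r k i => ?_⟩
  rw [State.setReg_get, State.put_get, hg]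
  by_cases h : r = 3 ∧ i = k
  · obtain ⟨rfl, rfl⟩ := h
    rcases lt_trichotomy i j with h2 | rfl | h2
    · simp [h2, h2.ne, Nat.lt_succ_of_lt h2]
    · simp
    · simp [h2.ne', h2.not_gt, show ¬ i < j + 1 by omega]
  · rw [if_neg (by omega), if_neg (by tauto), if_neg (by tauto)]

/-- Assign one more tuple. -/
def augment : Prog :=
  .seq clearMarks (.seq search (.seq select (.seq (copyRow 3 1)
    (.put 2 (.reg 3) (.reg 3) (.add (.get 2 (.reg 3) (.reg 3)) (.const 1))))))

theorem WP.augment {U n m u : ℕ} {q : ℕ → ℕ → ℚ} {μ : ℕ → ℚ} {s : State} (hnU : n ≤ U)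
    (hmU : m ≤ U) (hadm : ∀ i < n, ∃ k < m, Adm q i k) (h : Solved n m q μ (u + 1) s) :
    WP U augment (fun s' => s'.reg 2 = s.reg 2 ∧ Solved n m q μ u s') s := by
  obtain ⟨hin, hF, hm1, w, hrow, hcnt, hval, hu, y, hy⟩ := h
  refine WP.seq ((WP.clearMarks hin.reg_one hmU).mono fun s1 ⟨hf1, hg1⟩ => ?_)
  have hM1 : Searching n m q w {m} s1 := by
    refine ⟨hin.frame hf1 (by norm_num), fun _ => w, search_init hval fun _ _ => rfl, ?_, ?_⟩
    · intro k hk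
      rw [hg1]
      rcases hk.lt_or_eq with hk | rfl
      · simp [hk, hk.ne]
      · simpa using hm1
    · intro k hk i hi
      obtain rfl := Finset.mem_singleton.mp hk
      rw [hg1, if_neg (by omega), hrow i hi]
  refine WP.seq ((WP.search hnU hmU hval hM1).mono fun s2 ⟨hf2, M, ⟨hin2, V, hS, hmark, hrows⟩,
    hclosed⟩ => ?_)
  have hg2 : ∀ r < 3, ∀ k i, s2.get r k i = s.get r k i := fun r hr k i => by
    rw [hf2.2 r hr, hg1, if_neg (by omega)]
  have hF2 : Fractions m μ s2 := hF.congr fun r hr => hg2 r (by omega)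
  -- Some tuple is unassigned, and by closedness its admissible groups have been reached.
  have hex : ∃ k < m, k ∈ M := by
    obtain ⟨i, hi, hwi⟩ : ∃ i < n, w i = m := by
      by_contra! hc
      have : cnt n w m = 0 := Finset.sum_eq_zero fun i hi =>
        if_neg (hc i (Finset.mem_range.mp hi))
      omega
    obtain ⟨k, hk, ha⟩ := hadm i hi
    exact ⟨k, hk, hclosed i hi (hwi ▸ hS.source_mem) k hk ha⟩
  refine WP.seq ((WP.select hmU hin2.reg_one hF2 hmark hex).mono
    fun s3 ⟨hf3, hg3, b, hbm, h3, hbM, hmin⟩ => ?_)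
  have hin3 := hin2.frame hf3 (by norm_num)
  refine WP.seq ((WP.copyRow hin3.reg_zero hnU (by norm_num) (by norm_num) h3
    hin3.reg_one).mono fun s4 ⟨hf4, hg4⟩ => ?_)
  have h3' : s4.reg 3 = b := (hf4.1 3 (by norm_num)).trans h3
  have hc4 : ∀ r < 3, ∀ k i, s4.get r k i = s.get r k i := fun r hr k i => by
    rw [hg4, if_neg (by omega), hg3, hg2 r hr]
  refine WP.put (k := b) (i := b) (v := cnt n w b + 1) h3' h3' ?_ ?_ ?_
  · simp only [Expr.eval]
    rw [Expr.eval_get (ek := .reg 3) (ei := .reg 3) h3' h3', hc4 2 (by norm_num), hcnt b hbm]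
  -- The new count is that of `V b` at `b`, hence at most `n`.
  · have h4 := hS.count b hbM b
    rw [if_neg hbm.ne, if_pos rfl] at h4
    have h5 := cnt_le n (V b) b
    exact_mod_cast natAbs_cast_lt_two_pow (k := cnt n w b + 1) (U := U) (by omega)
  · refine ⟨?_, (hin3.frame hf4 (by norm_num)).frame ((Frame.refl 2 _).put _ _ _ _) le_rfl,
      hF.congr fun r hr k i => ?_, ?_, V b, ?_, ?_, hS.valid b hbM, ?_, ?_⟩
    · rw [State.put_reg, hf4.1 2 (by norm_num), hf3.1 2 (by norm_num), hf2.1.1 2 (by norm_num),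
        hf1.1 2 (by norm_num)]
    · rw [State.put_get, if_neg (by omega), hc4 r (by omega)]
    · rw [State.put_get, if_neg (by omega), hg4, if_neg (by omega), hg3, hmark m le_rfl,
        if_pos hS.source_mem]
    · intro i hi
      rw [State.put_get, if_neg (by omega), hg4, if_pos ⟨rfl, rfl, hi⟩, hg3, hrows b hbM i hi]
    · intro k hk
      have h4 := hS.count b hbM k
      rw [if_neg hk.ne, add_zero] at h4
      rw [State.put_get, h4]
      by_cases hkb : k = b
      · simp [hkb]
      · simp [hkb, hc4 2, hcnt k hk]
    · have h4 := hS.count b hbM m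
      rw [if_pos rfl, if_neg hbm.ne'] at h4
      omega
    · refine hS.exists_isPotential hclosed hbm hbM (fun k hk hkM => ?_) hy
      have h4 := hmin k hk hkM
      rw [hg2 2 (by norm_num), hg2 2 (by norm_num), hcnt b hbm, hcnt k hk] at h4
      exact_mod_cast h4

/-! ### The whole program -/

/-- Compute the fractions in the arrays `0` and `1`. -/
def means : Prog :=
  .forTo 2 1 (.seq (.put 1 (.reg 2) (.reg 2) (.const 1)) (.forTo 3 0 (.seq
    (.put 0 (.reg 2) (.reg 2) (.add (.mul (.get 0 (.reg 2) (.reg 2)) (.den (.reg 3) (.reg 2)))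
      (.mul (.num (.reg 3) (.reg 2)) (.get 1 (.reg 2) (.reg 2)))))
    (.put 1 (.reg 2) (.reg 2) (.mul (.get 1 (.reg 2) (.reg 2)) (.den (.reg 3) (.reg 2)))))))

/-- Common denominator of `q 0 j, …, q (i - 1) j`. -/
def commonDen (q : ℕ → ℕ → ℚ) (i j : ℕ) : ℕ := ∏ i' ∈ Finset.range i, (q i' j).den

theorem commonDen_pos (q : ℕ → ℕ → ℚ) (i j : ℕ) : 0 < commonDen q i j :=
  Finset.prod_pos fun i' _ => (q i' j).den_pos

/-- The common denominators are small enough for the fractions to be computed within `U` bits. -/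
def Small (U n m : ℕ) (q : ℕ → ℕ → ℚ) : Prop :=
  ∀ j < m, ∀ i ≤ n, (n + 1) * commonDen q i j < 2 ^ U

/-- Adding fractions without reduction keeps the denominator equal to `commonDen`. The numerator is
updated first because it uses the old denominator. -/
theorem WP.meansRow {U n m j : ℕ} {q : ℕ → ℕ → ℚ} {s : State} (hnU : n ≤ U)
    (hq : ∀ i j, 0 ≤ q i j ∧ q i j ≤ 1) (hsm : Small U n m q) (hin : Input n m q s) (hj : j < m)
    (h2 : s.reg 2 = j) (hA : s.get 0 j j = 0) (hB : s.get 1 j j = 1) :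
    WP U (.forTo 3 0 (.seq
      (.put 0 (.reg 2) (.reg 2) (.add (.mul (.get 0 (.reg 2) (.reg 2)) (.den (.reg 3) (.reg 2)))
        (.mul (.num (.reg 3) (.reg 2)) (.get 1 (.reg 2) (.reg 2)))))
      (.put 1 (.reg 2) (.reg 2) (.mul (.get 1 (.reg 2) (.reg 2)) (.den (.reg 3) (.reg 2))))))
    (fun s' => Frame 3 s s' ∧ (∀ r k i, ¬ (r < 2 ∧ k = j) → s'.get r k i = s.get r k i) ∧
      s'.get 1 j j = commonDen q n j ∧
      (s'.get 0 j j : ℚ) = (∑ i ∈ Finset.range n, q i j) * commonDen q n j) s := by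
  refine WP.forTo (fun i s' => Frame 3 s s' ∧
      (∀ r k i, ¬ (r < 2 ∧ k = j) → s'.get r k i = s.get r k i) ∧
      s'.get 1 j j = commonDen q i j ∧
      (s'.get 0 j j : ℚ) = (∑ i ∈ Finset.range i, q i j) * commonDen q i j)
    (by norm_num) hin.reg_zero hnU
    ⟨(Frame.refl _ _).setReg le_rfl _, fun _ _ _ _ => rfl, by simp [hB, commonDen],
      by simp [hA]⟩ ?_ fun s' h _ _ => h
  intro i hi s1 ⟨hf, hg, hB1, hA1⟩ h3 h0
  have hin1 := hin.frame hf (by norm_num)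
  have h2' : s1.reg 2 = j := (hf.1 2 (by norm_num)).trans h2
  have hD : commonDen q (i + 1) j = commonDen q i j * (q i j).den := Finset.prod_range_succ _ _
  have hs1 := hsm j hj (i + 1) hi
  have hA2 : ((s1.get 0 j j * (q i j).den + (q i j).num * s1.get 1 j j : ℤ) : ℚ)
      = (∑ i ∈ Finset.range (i + 1), q i j) * commonDen q (i + 1) j := by
    push_cast
    rw [hA1, hB1, hD, Finset.sum_range_succ]
    push_cast
    have : ((q i j).num : ℚ) = q i j * (q i j).den := (Rat.mul_den_eq_num _).symm
    rw [this]
    ring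
  refine WP.seq (WP.put (k := j) (i := j)
    (v := s1.get 0 j j * (q i j).den + (q i j).num * s1.get 1 j j) h2' h2' ?_ ?_ ?_)
  · simp only [Expr.eval]
    rw [Expr.eval_get (ek := .reg 2) (ei := .reg 2) h2' h2',
      Expr.eval_get (ek := .reg 2) (ei := .reg 2) h2' h2',
      hin1.eval_den hi hj (ei := .reg 3) (ej := .reg 2) h3 h2',
      hin1.eval_num hi hj (ei := .reg 3) (ej := .reg 2) h3 h2']
  -- Probabilities lie in `[0, 1]`, so the numerator is between 0 and `n` times the common
  -- denominator, within the limit set by `Small`.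
  · have hsum0 : 0 ≤ ∑ i ∈ Finset.range (i + 1), q i j :=
      Finset.sum_nonneg fun i _ => (hq i j).1
    have hsum1 : ∑ i ∈ Finset.range (i + 1), q i j ≤ n := by
      calc ∑ i ∈ Finset.range (i + 1), q i j ≤ ∑ _i ∈ Finset.range (i + 1), (1 : ℚ) :=
            Finset.sum_le_sum fun i _ => (hq i j).2
        _ ≤ n := by simpa using by exact_mod_cast hi
    have hc : (0 : ℚ) ≤ commonDen q (i + 1) j := Nat.cast_nonneg _
    have h4 := mul_nonneg hsum0 hc
    have h5 := mul_le_mul_of_nonneg_right hsum1 hc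
    rw [← hA2] at h4 h5
    have h6 : (0 : ℤ) ≤ s1.get 0 j j * (q i j).den + (q i j).num * s1.get 1 j j := by
      exact_mod_cast h4
    have h7 : s1.get 0 j j * (q i j).den + (q i j).num * s1.get 1 j j
        ≤ ((n * commonDen q (i + 1) j : ℕ) : ℤ) := by
      exact_mod_cast h5
    rw [add_mul] at hs1
    omega
  · have h4 : ((s1.put 0 j j (s1.get 0 j j * (q i j).den + (q i j).num * s1.get 1 j j)).get 1 j j)
        = commonDen q i j := by
      rw [State.put_get, if_neg (by omega), hB1]
    refine WP.put (k := j) (i := j) (v := (commonDen q (i + 1) j : ℕ)) h2' h2' ?_ ?_ ?_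
    · have hin2 := hin1.frame ((Frame.refl 2 _).put 0 j j
        (s1.get 0 j j * (q i j).den + (q i j).num * s1.get 1 j j)) le_rfl
      simp only [Expr.eval]
      rw [Expr.eval_get (s := s1.put 0 j j _) (ek := .reg 2) (ei := .reg 2) h2' h2', h4,
        hin2.eval_den hi hj (ei := .reg 3) (ej := .reg 2) h3 h2', hD]
      push_cast
      rfl
    · rw [Int.natAbs_natCast]
      exact lt_of_le_of_lt (Nat.le_mul_of_pos_left _ n.succ_pos) hs1
    · refine ⟨h3, h0, ((hf.put _ _ _ _).put _ _ _ _).setReg le_rfl _, fun r k l hrk => ?_, ?_, ?_⟩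
      · rw [State.setReg_get, State.put_get, if_neg (by omega), State.put_get,
          if_neg (by omega), hg r k l hrk]
      · simp [State.put_get]
      · rw [State.setReg_get, State.put_get, if_neg (by omega), State.put_get, if_pos (by simp),
          hA2]

/-- The untouched zeros matter later: they are the initial counts and the denominator of the
sentinel `-1 / 0`. -/
theorem WP.means {U n m : ℕ} {q : ℕ → ℕ → ℚ} {s : State} (hnU : n ≤ U) (hmU : m ≤ U)
    (hq : ∀ i j, 0 ≤ q i j ∧ q i j ≤ 1) (hsm : Small U n m q) (hin : Input n m q s)
    (h0 : ∀ r k i, s.get r k i = 0) :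
    WP U means (fun s' => Frame 2 s s' ∧ (∀ r k i, ¬ (r < 2 ∧ k < m) → s'.get r k i = 0) ∧
      (∀ j < m, s'.get 1 j j = commonDen q n j ∧
        (s'.get 0 j j : ℚ) = (∑ i ∈ Finset.range n, q i j) * commonDen q n j)) s := by
  refine WP.forTo (fun j s' => Frame 2 s s' ∧ (∀ r k i, ¬ (r < 2 ∧ k < j) → s'.get r k i = 0) ∧
      (∀ j' < j, s'.get 1 j' j' = commonDen q n j' ∧
        (s'.get 0 j' j' : ℚ) = (∑ i ∈ Finset.range n, q i j') * commonDen q n j'))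
    (by norm_num) hin.reg_one hmU
    ⟨(Frame.refl _ _).setReg le_rfl _, fun r k i _ => h0 r k i, by simp⟩ ?_ fun s' h _ _ => h
  intro j hj s1 ⟨hf, hg, hj1⟩ h2 h1
  have hf' := hf.put 1 j j 1
  refine WP.seq (WP.put (k := j) (i := j) (v := 1) h2 h2 rfl
    (by simpa using natAbs_cast_lt_two_pow (k := 1) (U := U) (by omega)) ?_)
  refine (WP.meansRow hnU hq hsm (hin.frame hf' le_rfl) hj h2 ?_ ?_).mono
    fun s2 ⟨hf2, hg2, hB, hA⟩ => ⟨(hf2.1 2 (by norm_num)).trans h2,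
      (hf2.1 1 (by norm_num)).trans h1,
      (hf'.trans (hf2.anti (by norm_num))).setReg le_rfl _, fun r k i hrk => ?_, fun j' hj' => ?_⟩
  · rw [State.put_get, if_neg (by omega), hg _ _ _ (by omega)]
  · simp [State.put_get]
  · rw [State.setReg_get, hg2 r k i (by omega), State.put_get, if_neg (by omega),
      hg r k i (by omega)]
  · simp only [State.setReg_get]
    rcases Nat.lt_succ_iff_lt_or_eq.mp hj' with hj' | rfl
    · rw [hg2 1 _ _ (by omega), hg2 0 _ _ (by omega), State.put_get, if_neg (by omega),
        State.put_get, if_neg (by omega)]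
      exact hj1 j' hj'
    · exact ⟨hB, hA⟩

/-- Set up the data structures, with all tuples unassigned. -/
def setup : Prog :=
  .seq means (.seq (.put 0 (.reg 1) (.reg 1) (.const (-1)))
    (.seq (.put 3 (.reg 1) (.reg 1) (.const 1)) (.forTo 2 0 (.put 4 (.reg 1) (.reg 2) (.reg 1)))))

theorem WP.setup {U n m : ℕ} {q : ℕ → ℕ → ℚ} {s : State} (hnU : n ≤ U) (hmU : m ≤ U) (hU : 1 ≤ U)
    (hq : ∀ i j, 0 ≤ q i j ∧ q i j ≤ 1) (hsm : Small U n m q) (hin : Input n m q s)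
    (h0 : ∀ r k i, s.get r k i = 0) :
    WP U setup (Solved n m q (fun j => ∑ i ∈ Finset.range n, q i j) n) s := by
  refine WP.seq ((WP.means hnU hmU hq hsm hin h0).mono fun s1 ⟨hf, hg, hfrac⟩ => ?_)
  have hin1 := hin.frame hf le_rfl
  have h1U : 1 < 2 ^ U := hU.trans_lt Nat.lt_two_pow_self
  refine WP.seq (WP.put (k := m) (i := m) (v := -1) hin1.reg_one hin1.reg_one rfl
    (by simpa using h1U) ?_)
  refine WP.seq (WP.put (k := m) (i := m) (v := 1) hin1.reg_one hin1.reg_one rfl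
    (by simpa using h1U) ?_)
  set s2 := (s1.put 0 m m (-1)).put 3 m m 1 with hs2
  have hf2 : Frame 2 s1 s2 := ((Frame.refl 2 _).put _ _ _ _).put _ _ _ _
  have hin2 := hin1.frame hf2 le_rfl
  refine WP.forTo (fun i s' => Frame 2 s2 s' ∧ (∀ r < 4, ∀ k x, s'.get r k x = s2.get r k x) ∧
    ∀ x < i, s'.get 4 m x = m) (by norm_num) hin2.reg_zero hnU
    ⟨(Frame.refl _ _).setReg le_rfl _, fun _ _ _ _ => rfl, by simp⟩ ?_ ?_
  · intro i hi s3 ⟨hf3, hg3, hr3⟩ h2 hr0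
    have h1 : s3.reg 1 = m := (hf3.1 1 (by norm_num)).trans hin2.reg_one
    refine WP.put (k := m) (i := i) (v := (m : ℤ)) h1 h2 h1 (natAbs_cast_lt_two_pow hmU)
      ⟨h2, hr0, (hf3.put _ _ _ _).setReg le_rfl _, fun r hr k x => ?_, fun x hx => ?_⟩
    · rw [State.setReg_get, State.put_get, if_neg (by omega), hg3 r hr]
    · rw [State.setReg_get, State.put_get]
      by_cases hxi : x = i
      · simp [hxi]
      · rw [if_neg (by tauto), hr3 x (by omega)]
  · intro s3 ⟨hf3, hg3, hr3⟩ _ _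
    have hget : ∀ r < 4, ∀ k x, s3.get r k x = if r = 3 ∧ k = m ∧ x = m then 1 else
        if r = 0 ∧ k = m ∧ x = m then -1 else s1.get r k x := fun r hr k x => by
      rw [hg3 r hr, hs2, State.put_get, State.put_get]
    have hcm : ∀ k, cnt n (fun _ => m) k = if m = k then n else 0 := fun k => by
      unfold cnt
      split_ifs <;> simp
    -- With all real counts zero, `-μ` is a potential; its feasibility is vacuous because no tuple
    -- is assigned.
    refine ⟨hin2.frame hf3 le_rfl, ⟨?_, ?_, ?_, ?_⟩, ?_, fun _ => m, hr3, ?_, ?_, ?_,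
      fun k => - ∑ i ∈ Finset.range n, q i k, ?_, ?_⟩
    · intro k hk
      rw [hget 1 (by norm_num), if_neg (by omega), if_neg (by omega), (hfrac k hk).1]
      exact_mod_cast commonDen_pos q n k
    · intro k hk
      rw [hget 0 (by norm_num), if_neg (by omega), if_neg (by omega), (hfrac k hk).2,
        hget 1 (by norm_num), if_neg (by omega), if_neg (by omega), (hfrac k hk).1]
      simp
    · rw [hget 0 (by norm_num), if_neg (by omega), if_pos ⟨rfl, rfl, rfl⟩]
    · rw [hget 1 (by norm_num), if_neg (by omega), if_neg (by omega), hg _ _ _ (by omega)]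
    · rw [hget 3 (by norm_num), if_pos ⟨rfl, rfl, rfl⟩]
    · intro k hk
      rw [hget 2 (by norm_num), if_neg (by omega), if_neg (by omega), hg _ _ _ (by omega), hcm,
        if_neg hk.ne']
      rfl
    · exact fun i _ => ⟨le_rfl, fun h => absurd h (lt_irrefl m)⟩
    · rw [hcm, if_pos rfl]
    · exact fun i _ h => absurd h (lt_irrefl m)
    · intro k hk
      rw [hcm, if_neg hk.ne']
      constructor <;> push_cast <;> linarith

/-- Copy the counts to the cells `0, …, m - 1`. -/
def output : Prog := .forTo 2 1 (.store (.reg 2) (.get 2 (.reg 2) (.reg 2)))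

/-- Overwriting the input is harmless: the counts live at negative addresses. -/
theorem WP.output {U m : ℕ} {s : State} (hmU : m ≤ U) (h1 : s.reg 1 = m) :
    WP U output (fun s' => ∀ j < m, s'.mem (j : ℤ) = s.get 2 j j) s := by
  refine WP.forTo (fun j s' => (∀ k, s'.get 2 k k = s.get 2 k k) ∧
    ∀ j' < j, s'.mem (j' : ℤ) = s.get 2 j' j') (by norm_num) h1 hmU
    ⟨fun _ => rfl, by simp⟩ ?_ fun s' h _ _ => h.2
  intro j hj s1 ⟨hg, hmem⟩ h2 h1'
  have hev := Expr.eval_get (r := 2) (ek := .reg 2) (ei := .reg 2) h2 h2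
  refine WP.of_bounded fun hs => WP.store (by rw [hev]; exact hs.get _ _ _) ?_
  rw [hev, show (Expr.reg 2).eval s1 = j from h2]
  refine ⟨h2, h1', fun k => ?_, fun j' hj' => ?_⟩
  · rw [State.setReg_get, State.setMem_get _ _ _ _ _ (by positivity), hg]
  · rw [State.setReg_mem, State.setMem_mem]
    by_cases h : j' = j
    · rw [if_pos (by exact_mod_cast h), hg, h]
    · rw [if_neg (by exact_mod_cast h), hmem j' (by omega)]

/-- Counts of an assignment closest to the means. -/
def closest : Prog := .seq setup (.seq (.forTo 2 0 augment) output)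

theorem WP.closest {U n m : ℕ} {q : ℕ → ℕ → ℚ} {s : State} (hnU : n ≤ U) (hmU : m ≤ U)
    (hU : 1 ≤ U) (hq : ∀ i j, 0 ≤ q i j ∧ q i j ≤ 1) (hsm : Small U n m q)
    (hadm : ∀ i < n, ∃ k < m, Adm q i k) (hin : Input n m q s) (h0 : ∀ r k i, s.get r k i = 0) :
    WP U closest (fun s' => ∃ w : ℕ → ℕ, (∀ j < m, s'.mem (j : ℤ) = cnt n w j) ∧
      (∀ i < n, w i < m ∧ Adm q i (w i)) ∧
      ∃ y, IsPotential n m (Adm q) (fun j => ∑ i ∈ Finset.range n, q i j) w y) s := by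
  refine WP.seq ((WP.setup hnU hmU hU hq hsm hin h0).mono fun s1 h1 => WP.seq ?_)
  -- Each augmentation leaves one unassigned tuple fewer; after `n` of them the group `m` is empty.
  refine WP.forTo (fun t s' => Solved n m q (fun j => ∑ i ∈ Finset.range n, q i j) (n - t) s')
    (by norm_num) h1.1.reg_zero hnU (h1.setReg le_rfl _) ?_ ?_
  · intro t ht s2 h2 hr2 hr0
    rw [show n - t = n - (t + 1) + 1 by omega] at h2
    exact (WP.augment hnU hmU hadm h2).mono fun s3 ⟨h3, h4⟩ =>
      ⟨h3.trans hr2, h4.1.reg_zero, h4.setReg le_rfl _⟩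
  · rintro s2 ⟨hin2, -, -, w, -, hcnt, hval, hu, hy⟩ - -
    refine (WP.output hmU hin2.reg_one).mono fun s3 h3 =>
      ⟨w, fun j hj => (h3 j hj).trans (hcnt j hj), fun i hi => ?_, hy⟩
    have hlt : w i < m := by
      refine lt_of_le_of_ne (hval i hi).1 fun e => ?_
      rw [Nat.sub_self, cnt, Finset.sum_eq_zero_iff] at hu
      simpa [e] using hu i (Finset.mem_range.mpr hi)
    exact ⟨hlt, (hval i hi).2 hlt⟩

end RAM

/-! ### Encoding and size of the input. -/

namespace ProbRel

variable {n m : ℕ} (P : ProbRel n m)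

/-- The probabilities, extended by `0`. -/
def probNat (i j : ℕ) : ℚ := if h : i < n ∧ j < m then P.prob ⟨i, h.1⟩ ⟨j, h.2⟩ else 0

@[simp] theorem probNat_val (i : Fin n) (j : Fin m) : P.probNat i j = P.prob i j := by
  simp [probNat]

theorem prob_le_one (i : Fin n) (j : Fin m) : P.prob i j ≤ 1 :=
  (Finset.single_le_sum (fun j _ => P.nonneg i j) (Finset.mem_univ j)).trans_eq (P.sum_eq_one i)

theorem probNat_mem (i j : ℕ) : 0 ≤ P.probNat i j ∧ P.probNat i j ≤ 1 := by
  unfold probNat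
  split_ifs with h
  · exact ⟨P.nonneg _ _, P.prob_le_one _ _⟩
  · simp

theorem exists_adm {i : ℕ} (hi : i < n) : ∃ k < m, RAM.Adm P.probNat i k := by
  by_contra! h
  have h1 := P.sum_eq_one ⟨i, hi⟩
  have h2 : ∑ j, P.prob ⟨i, hi⟩ j ≤ 0 := Finset.sum_nonpos fun j _ => by
    have := h j j.2
    rw [RAM.Adm, not_lt] at this
    rwa [← P.probNat_val]
  linarith

theorem initState_mem_of_neg {z : ℤ} (hz : z < 0) : P.initState.mem z = 0 := by
  simp only [initState]
  refine Finset.sum_eq_zero fun i _ => Finset.sum_eq_zero fun j _ => ?_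
  have : (0 : ℤ) ≤ (i : ℤ) * m + j := by positivity
  rw [if_neg (by omega), if_neg (by omega), add_zero]

theorem index_inj {i i' : Fin n} {j j' : Fin m} :
    (i : ℤ) * m + j = (i' : ℤ) * m + j' ↔ i = i' ∧ j = j' := by
  refine ⟨fun h => ?_, by rintro ⟨rfl, rfl⟩; rfl⟩
  have h1 : (i : ℕ) * m + j = i' * m + j' := by exact_mod_cast h
  have hm : 0 < m := j.pos
  have h2 : (i : ℕ) = i' := by
    have := congrArg (· / m) h1
    simpa [Nat.add_comm, Nat.add_mul_div_right _ _ hm, Nat.div_eq_of_lt j.2,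
      Nat.div_eq_of_lt j'.2] using this
  rw [h2] at h1
  exact ⟨Fin.ext h2, Fin.ext (by omega)⟩

theorem initState_mem_num (i : Fin n) (j : Fin m) :
    P.initState.mem (2 * ((i : ℤ) * m + j)) = (P.prob i j).num := by
  have h : ∀ (i' : Fin n) (j' : Fin m),
      ((if 2 * ((i : ℤ) * m + j) = 2 * ((i' : ℤ) * m + j') then (P.prob i' j').num else 0) +
        (if 2 * ((i : ℤ) * m + j) = 2 * ((i' : ℤ) * m + j') + 1 then ((P.prob i' j').den : ℤ)
          else 0)) = if i = i' then (if j = j' then (P.prob i' j').num else 0) else 0 := by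
    intro i' j'
    -- Numerators are at even addresses and denominators at odd ones.
    rw [if_neg (c := _ = _ + 1) (by omega), add_zero, ← ite_and]
    exact if_congr (by rw [← index_inj]; omega) rfl rfl
  simp only [initState, h]
  simp

theorem initState_mem_den (i : Fin n) (j : Fin m) :
    P.initState.mem (2 * ((i : ℤ) * m + j) + 1) = (P.prob i j).den := by
  have h : ∀ (i' : Fin n) (j' : Fin m),
      ((if 2 * ((i : ℤ) * m + j) + 1 = 2 * ((i' : ℤ) * m + j') then (P.prob i' j').num else 0) +
        (if 2 * ((i : ℤ) * m + j) + 1 = 2 * ((i' : ℤ) * m + j') + 1 then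
          ((P.prob i' j').den : ℤ) else 0))
        = if i = i' then (if j = j' then ((P.prob i' j').den : ℤ) else 0) else 0 := by
    intro i' j'
    rw [if_neg (by omega), zero_add, ← ite_and]
    exact if_congr (by rw [← index_inj]; omega) rfl rfl
  simp only [initState, h]
  simp

theorem initState_input : RAM.Input n m P.probNat P.initState where
  reg_zero := rfl
  reg_one := rfl
  num i hi j hj := by
    simpa using (P.initState_mem_num ⟨i, hi⟩ ⟨j, hj⟩).trans
      (by rw [← P.probNat_val ⟨i, hi⟩ ⟨j, hj⟩])
  den i hi j hj := by
    simpa using (P.initState_mem_den ⟨i, hi⟩ ⟨j, hj⟩).trans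
      (by rw [← P.probNat_val ⟨i, hi⟩ ⟨j, hj⟩])

theorem sum_len_den_le (j : Fin m) : ∑ i, RAM.len ((P.prob i j).den : ℤ) ≤ P.inputSize := by
  refine le_trans (Finset.sum_le_sum fun i _ => ?_) (Nat.le_add_left _ (n + m))
  exact (Nat.le_add_left _ _).trans (Finset.single_le_sum
    (f := fun j => RAM.len (P.prob i j).num + RAM.len ((P.prob i j).den : ℤ))
    (fun _ _ => Nat.zero_le _) (Finset.mem_univ j))

theorem len_num_le (i : Fin n) (j : Fin m) : RAM.len (P.prob i j).num ≤ P.inputSize := by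
  refine le_trans ?_ (Nat.le_add_left _ (n + m))
  refine le_trans ?_ (Finset.single_le_sum
    (f := fun i => ∑ j, (RAM.len (P.prob i j).num + RAM.len ((P.prob i j).den : ℤ)))
    (fun _ _ => Nat.zero_le _) (Finset.mem_univ i))
  exact (Nat.le_add_right _ _).trans (Finset.single_le_sum
    (f := fun j => RAM.len (P.prob i j).num + RAM.len ((P.prob i j).den : ℤ))
    (fun _ _ => Nat.zero_le _) (Finset.mem_univ j))

/-- Each denominator is below 2 to the power of its length, and the lengths in one column add up to
at most the input size. -/
theorem commonDen_le {j : ℕ} (hj : j < m) : RAM.commonDen P.probNat n j ≤ 2 ^ P.inputSize := by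
  refine le_trans ?_ (Nat.pow_le_pow_right (n := 2) (by norm_num) (P.sum_len_den_le ⟨j, hj⟩))
  rw [RAM.commonDen, ← Fin.prod_univ_eq_prod_range (fun i => (P.probNat i j).den) n,
    ← Finset.prod_pow_eq_pow_sum]
  refine Finset.prod_le_prod' fun i _ => ?_
  rw [show P.probNat i j = P.prob i ⟨j, hj⟩ from P.probNat_val i ⟨j, hj⟩]
  simpa using (RAM.natAbs_lt_two_pow_len ((P.prob i ⟨j, hj⟩).den : ℤ)).le

/-- This fixes the word length: `inputSize` bits for the common denominator and `inputSize + 2` for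
the factor `n + 1`. -/
theorem small_probNat : RAM.Small (2 * P.inputSize + 2) n m P.probNat := by
  intro j hj i hi
  have h1 : RAM.commonDen P.probNat i j ≤ 2 ^ P.inputSize := by
    refine le_trans ?_ (P.commonDen_le hj)
    exact Finset.prod_le_prod_of_subset_of_one_le' (Finset.range_mono hi)
      fun i _ _ => (P.probNat i j).den_pos
  have h2 : n + 1 < 2 ^ (P.inputSize + 2) := by
    have : n ≤ P.inputSize := by unfold inputSize; omega
    have := Nat.lt_two_pow_self (n := P.inputSize + 2)
    omega
  calc (n + 1) * RAM.commonDen P.probNat i j ≤ (n + 1) * 2 ^ P.inputSize := by gcongr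
    _ < 2 ^ (P.inputSize + 2) * 2 ^ P.inputSize := by gcongr
    _ = 2 ^ (2 * P.inputSize + 2) := by rw [← pow_add]; congr 1; omega

theorem initState_bounded : RAM.Bounded (2 * P.inputSize + 2) P.initState := by
  constructor
  · intro k
    simp only [initState]
    split_ifs
    · exact RAM.natAbs_cast_lt_two_pow (by unfold inputSize; omega)
    · exact RAM.natAbs_cast_lt_two_pow (by unfold inputSize; omega)
    · simp
  · intro z
    by_cases h : ∃ (i : Fin n) (j : Fin m), z = 2 * ((i : ℤ) * m + j)
    · obtain ⟨i, j, rfl⟩ := h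
      rw [initState_mem_num]
      refine (RAM.natAbs_lt_two_pow_len _).trans_le (Nat.pow_le_pow_right (by norm_num) ?_)
      have := P.len_num_le i j
      omega
    by_cases h' : ∃ (i : Fin n) (j : Fin m), z = 2 * ((i : ℤ) * m + j) + 1
    · obtain ⟨i, j, rfl⟩ := h'
      rw [initState_mem_den]
      refine (RAM.natAbs_lt_two_pow_len _).trans_le (Nat.pow_le_pow_right (by norm_num) ?_)
      have h1 := P.sum_len_den_le j
      have h2 := Finset.single_le_sum (f := fun i => RAM.len ((P.prob i j).den : ℤ))
        (fun _ _ => Nat.zero_le _) (Finset.mem_univ i)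
      omega
    · push Not at h h'
      have : P.initState.mem z = 0 := by
        simp only [initState]
        refine Finset.sum_eq_zero fun i _ => Finset.sum_eq_zero fun j _ => ?_
        rw [if_neg (h i j), if_neg (h' i j), add_zero]
      simp [this]

theorem isClosestToMean_of_isPotential {w : ℕ → ℕ}
    (hw : ∀ i < n, w i < m ∧ RAM.Adm P.probNat i (w i)) {y : ℕ → ℚ}
    (hy : Assign.IsPotential n m (RAM.Adm P.probNat)
      (fun j => ∑ i ∈ Finset.range n, P.probNat i j) w y) :
    P.IsClosestToMean fun j => Assign.cnt n w j := by
  set v : Fin n → Fin m := fun i => ⟨w i, (hw i i.2).1⟩ with hv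
  have hcnt : (fun j : Fin m => Assign.cnt n w j) = groupCount v := by
    funext j
    rw [Assign.cnt, groupCount, Finset.card_filter,
      ← Fin.sum_univ_eq_sum_range (fun i => if w i = j then 1 else 0) n]
    simp [hv, Fin.ext_iff]
  have hμ : ∀ j : Fin m, ((∑ i ∈ Finset.range n, P.probNat i j : ℚ) : ℝ)
      = ∑ i, (P.prob i j : ℝ) := by
    intro j
    rw [← Fin.sum_univ_eq_sum_range (fun i => P.probNat i j) n]
    simp
  have hc : ∀ j : Fin m, (groupCount v j : ℝ) = (Assign.cnt n w j : ℚ) := by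
    intro j
    rw [← hcnt]
    simp
  rw [hcnt]
  refine P.isClosestToMean_of_potential v (fun i => ?_) (fun j => (y j : ℝ)) ?_ ?_ ?_
  · rw [← P.probNat_val]
    exact (hw i i.2).2
  · intro j
    rw [← hμ, hc]
    exact_mod_cast (hy.2 j j.2).1
  · intro j
    rw [← hμ, hc]
    exact_mod_cast (hy.2 j j.2).2
  · intro i k hk
    rw [← P.probNat_val] at hk
    exact_mod_cast hy.1 i i.2 (hw i i.2).1 k k.2 hk

end ProbRel

theorem mainTheorem11 :
    ∃ (c : RAM.Prog) (q : Polynomial ℕ), ∀ (n m : ℕ) (P : ProbRel n m),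
      ∃ (t : ℕ) (s : RAM.State) (a : Fin m → ℕ),
        RAM.Exec c P.initState t s ∧
        t ≤ q.eval P.inputSize ∧
        (∀ j : Fin m, s.mem (j : ℤ) = (a j : ℤ)) ∧
        P.IsClosestToMean a ∧
        P.IsApproxMedianAnswer 4 a := by
  -- The time bound is evaluated at the word length `U = 2 * inputSize + 2`.
  refine ⟨RAM.closest, RAM.closest.timeBound.comp
    (Polynomial.C 2 * Polynomial.X + Polynomial.C 2), fun n m P => ?_⟩
  have hn : n ≤ 2 * P.inputSize + 2 := by unfold ProbRel.inputSize; omega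
  have hm : m ≤ 2 * P.inputSize + 2 := by unfold ProbRel.inputSize; omega
  obtain ⟨t, s, hexec, ht, -, w, hmem, hw, y, hy⟩ :=
    RAM.WP.closest hn hm (by omega) P.probNat_mem P.small_probNat (fun i => P.exists_adm)
      P.initState_input (fun r k i => P.initState_mem_of_neg (RAM.cell_neg r k i))
      P.initState_bounded
  have hclosest := P.isClosestToMean_of_isPotential hw hy
  refine ⟨t, s, fun j => Assign.cnt n w j, hexec, ?_, fun j => hmem j j.2, hclosest,
    hclosest.isApproxMedianAnswer⟩
  simpa [Polynomial.eval_comp] using ht
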